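/- Let $\mathcal{E}$ be an elliptic curve over a finite field $\mathbb{F}_q$, given by a Weierstrass equation $Y^2+a_1XY+a_3Y=X^3+a_2X^2+a_4X+a_6$ with point at infinity $P_\infty$, and let $K=\mathbb{F}_q(\mathcal{E})$ be its function field. Let $\sigma\in\operatorname{Aut}(K/\mathbb{F}_q)\cong\operatorname{Aut}(\mathcal{E}/\mathbb{F}_q)$ be an automorphism that fixes $P_\infty$ and whose order $\ell$ is $2$, $4$ or $6$. For a rational point $Q$ put $\operatorname{Orb}_\sigma(Q)=\{\sigma^i(Q):0\le i<\ell\}$. Let $s\in\mathbb{N}$, let $t_1,\dots,t_s\in\mathbb{Z}$, let $Q_1,\dots,Q_s\in\mathcal{E}(\mathbb{F}_q)\setminus(\mathcal{E}[2]\cup\mathcal{E}[3])$, and set $$G=\sum_{z=1}^{s}t_z\sum_{Q\in\operatorname{Orb}_\sigma(Q_z)}Q .$$ Write $\mathcal{Q}_{z,\rho}=\sigma^{\rho-1}(Q_z)$ for $1\le\rho\le\ell$, and let $x(P)$ denote the $X$-coordinate of an affine point $P$. Then $\deg G=\ell\sum_{z=1}^{s}t_z$, and the functions $$\frac{X^iY^j}{\prod_{z=1}^{s}\Bigl[\prod_{\rho=1}^{\ell/2}\bigl(X-x(\mathcal{Q}_{z,\rho})\bigr)\Bigr]^{t_z}},\qquad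 i\in\mathbb{Z}_{\ge0},\ j\in\{0,1\},\ 2i+3j\le\ell\sum_{z=1}^{s}t_z,$$ indexed by the pairs $(i,j)$, form an $\mathbb{F}_q$-basis of the Riemann–Roch space $\mathscr{L}(G)=\{f\in K^{*}:(f)\ge-G\}\cup\{0\}$. -/

import Mathlib

open scoped Classical WithZero Pointwise Polynomial nonZeroDivisors

noncomputable section

namespace QCElliptic

section Places

variable (k K : Type*) [Field k] [Field K] [Algebra k K]

/-- A place of the function field `K / k`, given by its ring of regular functions: a discrete
valuation ring of `K` that contains the constants `k`. -/
@[ext]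
structure Place where
  ring : ValuationSubring K
  algebraMap_mem : ∀ c : k, algebraMap k K c ∈ ring
  isDVR : IsDiscreteValuationRing ring

variable {k K}

namespace Place

instance (P : Place k K) : IsDiscreteValuationRing P.ring := P.isDVR

instance (P : Place k K) : Algebra k P.ring :=
  ((algebraMap k K).codRestrict P.ring P.algebraMap_mem).toAlgebra

/-- The multiplicative form `exp (-v_P)` of the normalized discrete valuation at `P`. -/
def valuation (P : Place k K) : Valuation K ℤᵐ⁰ :=
  (IsDiscreteValuationRing.maximalIdeal P.ring).valuation K

/-- The order `v_P(f)` of a nonzero function `f` at `P`. -/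
def ord (P : Place k K) (f : K) : ℤ := -WithZero.log (P.valuation f)

/-- The degree of a place: the degree of its residue field over `k`. -/
def degree (P : Place k K) : ℕ := Module.finrank k (IsLocalRing.ResidueField P.ring)

/-- The value `f(P) ∈ k` of a function `f` that is regular at the rational place `P`: the constant
`c` for which `f - c` vanishes at `P`. -/
def value (P : Place k K) (f : K) : k :=
  Classical.epsilon fun c => P.valuation (f - algebraMap k K c) < 1

theorem valuation_algebraMap_le_one (P : Place k K) (c : k) :
    P.valuation (algebraMap k K c) ≤ 1 :=
  (IsDiscreteValuationRing.maximalIdeal P.ring).valuation_le_one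
    (⟨algebraMap k K c, P.algebraMap_mem c⟩ : P.ring)

/-- An automorphism `σ` of `K / k` sends the place `P` with ring `O` to the place with ring
`σ(O)`. -/
instance : SMul (K ≃ₐ[k] K) (Place k K) where
  smul σ P :=
    { ring := σ • P.ring
      algebraMap_mem := fun c =>
        (ValuationSubring.mem_smul_pointwise_iff_exists σ _ P.ring).2
          ⟨algebraMap k K c, P.algebraMap_mem c, by simp⟩
      isDVR := by
        let e : P.ring ≃+* (σ • P.ring : ValuationSubring K) :=
          RingEquiv.ofBijective
            (((σ : K →+* K).comp P.ring.subtype).codRestrict (σ • P.ring : ValuationSubring K)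
              fun x => ValuationSubring.smul_mem_pointwise_smul σ _ _ x.2)
            ⟨fun x y h => Subtype.ext (σ.injective (congrArg Subtype.val h)),
             fun y => by
              obtain ⟨x, hx, hxy⟩ :=
                (ValuationSubring.mem_smul_pointwise_iff_exists σ _ P.ring).1 y.2
              exact ⟨⟨x, hx⟩, Subtype.ext hxy⟩⟩
        exact IsDiscreteValuationRing.RingEquivClass.isDiscreteValuationRing e }

/-- The orbit `{σ^i(P) : 0 ≤ i < ord σ}`. -/
def orbit (σ : K ≃ₐ[k] K) (P : Place k K) : Finset (Place k K) :=
  (Finset.range (orderOf σ)).image fun i => σ ^ i • P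

end Place

variable (k K) in
/-- Divisors: finite formal integer combinations of places. -/
abbrev Divisor := Place k K →₀ ℤ

/-- The degree `∑ v_P(G) deg P`. -/
def Divisor.degree (G : Divisor k K) : ℤ := G.sum fun P n => n * (P.degree : ℤ)

theorem ord_ge_iff (P : Place k K) (n : ℤ) {f : K} (hf : f ≠ 0) :
    -n ≤ P.ord f ↔ P.valuation f ≤ WithZero.exp n := by
  have h : P.valuation f ≠ 0 := (Valuation.ne_zero_iff _).2 hf
  rw [Place.ord, neg_le_neg_iff, WithZero.log_le_iff_le_exp h]

theorem mem_riemannRoch_iff (G : Divisor k K) (f : K) :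
    (f = 0 ∨ ∀ P : Place k K, -G P ≤ P.ord f) ↔
      ∀ P : Place k K, P.valuation f ≤ WithZero.exp (G P) := by
  rcases eq_or_ne f 0 with rfl | hf
  · simp
  · simp only [hf, false_or]
    exact forall_congr' fun P => ord_ge_iff P _ hf

/-- The Riemann–Roch space `L(G) = {f : (f) ≥ -G} ∪ {0}`. -/
def riemannRochSpace (G : Divisor k K) : Submodule k K where
  carrier := {f | f = 0 ∨ ∀ P : Place k K, -G P ≤ P.ord f}
  zero_mem' := Or.inl rfl
  add_mem' {f g} hf hg := by
    simp only [Set.mem_ofPred_eq, mem_riemannRoch_iff] at *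
    exact fun P => Valuation.map_add_le _ (hf P) (hg P)
  smul_mem' c f hf := by
    simp only [Set.mem_ofPred_eq, mem_riemannRoch_iff] at *
    intro P
    rw [Algebra.smul_def, map_mul]
    exact (mul_le_mul' (P.valuation_algebraMap_le_one c) (hf P)).trans_eq (one_mul _)

end Places

theorem isDVR_of_mul_maximalIdeal {A : Type*} [CommRing A] [IsDomain A] [IsNoetherianRing A]
    [IsLocalRing A] (J : Ideal A) {ξ : A} (hξ0 : ξ ≠ 0)
    (hmul : J * IsLocalRing.maximalIdeal A = Ideal.span {ξ}) : IsDiscreteValuationRing A := by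
  have hprin : (IsLocalRing.maximalIdeal A).IsPrincipal := by
    refine Ideal.IsPrincipal.of_finite_maximals_of_isUnit ?_ ?_
    · exact (Set.finite_singleton (IsLocalRing.maximalIdeal A)).subset
        fun I hI => IsLocalRing.eq_maximalIdeal hI
    · refine isUnit_of_mul_isUnit_right (x := (J : FractionalIdeal A⁰ (FractionRing A))) ?_
      rw [← FractionalIdeal.coeIdeal_mul, hmul, FractionalIdeal.coeIdeal_span_singleton]
      exact IsUnit.of_mul_eq_one _ (FractionalIdeal.spanSingleton_mul_inv _ (by simpa using hξ0))
  have hne : IsLocalRing.maximalIdeal A ≠ ⊥ := by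
    intro hb
    rw [hb, Ideal.mul_bot, eq_comm, Ideal.span_singleton_eq_bot] at hmul
    exact hξ0 hmul
  exact ((IsDiscreteValuationRing.TFAE A
    (fun hf => hne (IsLocalRing.isField_iff_maximalIdeal_eq.1 hf))).out 0 4).2 hprin

section Curve

open WeierstrassCurve.Affine WeierstrassCurve.Affine.CoordinateRing

variable {F : Type*} [Field F] (W : WeierstrassCurve F)

/-- The coordinate function `X` in the function field of the curve. -/
def X : W.toAffine.FunctionField :=
  algebraMap W.toAffine.CoordinateRing _ (mk W.toAffine (Polynomial.C Polynomial.X))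

/-- The coordinate function `Y` in the function field of the curve. -/
def Y : W.toAffine.FunctionField :=
  algebraMap W.toAffine.CoordinateRing _ (mk W.toAffine Polynomial.X)

section Affine

variable {W}

theorem isMaximal_XYIdeal {a b : F} (h : W.toAffine.Nonsingular a b) :
    (XYIdeal W.toAffine a (Polynomial.C b)).IsMaximal := by
  have e := quotientXYIdealEquiv (W' := W.toAffine) (x := a) (y := Polynomial.C b)
    (by simpa [WeierstrassCurve.Affine.Equation, Polynomial.evalEval] using h.1)
  exact Ideal.Quotient.maximal_of_isField _ (e.toMulEquiv.isField (Field.toIsField F))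

/-- The ideal `(X - a, Y - b)` of the functions vanishing at the point `(a, b)`. -/
def pointIdeal {a b : F} (_ : W.toAffine.Nonsingular a b) : Ideal W.toAffine.CoordinateRing :=
  XYIdeal W.toAffine a (Polynomial.C b)

instance {a b : F} (h : W.toAffine.Nonsingular a b) : (pointIdeal h).IsMaximal :=
  isMaximal_XYIdeal h

/-- The local ring of the curve at `(a, b)`: the fractions `g / s` of functions in the coordinate
ring with `s` not vanishing at `(a, b)`. -/
def localRing {a b : F} (h : W.toAffine.Nonsingular a b) :
    Subalgebra W.toAffine.CoordinateRing W.toAffine.FunctionField :=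
  Localization.subalgebra.ofField W.toAffine.FunctionField (pointIdeal h).primeCompl
    (Ideal.primeCompl_le_nonZeroDivisors _)

instance {a b : F} (h : W.toAffine.Nonsingular a b) :
    IsLocalization.AtPrime (localRing h) (pointIdeal h) :=
  Localization.subalgebra.isLocalization_ofField _ _ _

instance {a b : F} (h : W.toAffine.Nonsingular a b) :
    IsFractionRing (localRing h) W.toAffine.FunctionField :=
  Localization.subalgebra.isFractionRing_ofField _ _ _

instance {a b : F} (h : W.toAffine.Nonsingular a b) : IsLocalRing (localRing h) :=
  IsLocalization.AtPrime.isLocalRing _ (pointIdeal h)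

instance isNoetherianRing_coordinateRing : IsNoetherianRing W.toAffine.CoordinateRing :=
  inferInstanceAs (IsNoetherianRing (_ ⧸ Ideal.span {W.toAffine.polynomial}))

instance isDVR_localRing {a b : F} (h : W.toAffine.Nonsingular a b) :
    IsDiscreteValuationRing (localRing h) := by
  have hN : IsNoetherianRing (localRing h) :=
    IsLocalization.isNoetherianRing (pointIdeal h).primeCompl _ inferInstance
  have hmap : (pointIdeal h).map (algebraMap _ (localRing h)) =
      IsLocalRing.maximalIdeal (localRing h) :=
    IsLocalization.AtPrime.map_eq_maximalIdeal (pointIdeal h) (localRing h)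
  have hinj : Function.Injective (algebraMap W.toAffine.CoordinateRing (localRing h)) :=
    IsLocalization.injective _ (Ideal.primeCompl_le_nonZeroDivisors (pointIdeal h))
  set ξ : localRing h := algebraMap _ (localRing h) (XClass W.toAffine a) with hξ
  have hξ0 : ξ ≠ 0 := fun h0 => XClass_ne_zero (W' := W.toAffine) a
    (hinj (by rw [← hξ, h0, map_zero]))
  have hmul : (XYIdeal W.toAffine a (Polynomial.C (W.toAffine.negY a b))).map
      (algebraMap _ (localRing h)) * IsLocalRing.maximalIdeal (localRing h) = Ideal.span {ξ} := by
    rw [← hmap, pointIdeal, ← Ideal.map_mul, XYIdeal_neg_mul h, XIdeal, Ideal.map_span,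
      Set.image_singleton]
  exact isDVR_of_mul_maximalIdeal _ hξ0 hmul

/-- The rational place attached to the affine point `(a, b)`. -/
def affinePlace {a b : F} (h : W.toAffine.Nonsingular a b) :
    Place F W.toAffine.FunctionField where
  ring := .ofSubring (localRing h).toSubring fun f =>
    (ValuationRing.isInteger_or_isInteger (localRing h) f).imp
      (fun ⟨c, hc⟩ => hc ▸ c.2) (fun ⟨c, hc⟩ => hc ▸ c.2)
  algebraMap_mem c := by
    rw [IsScalarTower.algebraMap_apply F W.toAffine.CoordinateRing W.toAffine.FunctionField]
    exact (localRing h).algebraMap_mem _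
  isDVR := isDVR_localRing h

end Affine

section Infinity

instance finite_coordinateRing : Module.Finite F[X] W.toAffine.CoordinateRing :=
  .of_basis (CoordinateRing.basis W.toAffine)

/-- The multiplicative form `exp (-v_∞)` of the valuation at infinity on the coordinate ring:
a regular function `g ≠ 0` has at infinity a pole whose order is the degree of the norm of `g`
in `F[X]`, so that `X` has a pole of order 2 and `Y` a pole of order 3. -/
def infinityValuationAux : Valuation W.toAffine.CoordinateRing ℤᵐ⁰ where
  toFun g := if g = 0 then 0 else WithZero.exp ((Algebra.norm F[X] g).natDegree : ℤ)
  map_zero' := if_pos rfl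
  map_one' := by
    rw [if_neg one_ne_zero, map_one, Polynomial.natDegree_one]
    rfl
  map_mul' g h := by
    have key : ∀ g : W.toAffine.CoordinateRing, g ≠ 0 → Algebra.norm F[X] g ≠ 0 := fun g hg =>
      Algebra.norm_ne_zero_iff.2 hg
    by_cases hg : g = 0
    · simp [hg]
    by_cases hh : h = 0
    · simp [hh]
    simp only [hg, hh, mul_eq_zero, or_self, if_false, map_mul]
    rw [Polynomial.natDegree_mul (key g hg) (key h hh), ← WithZero.exp_add]
    push_cast
    rfl
  map_add_le_max' g h := by
    by_cases hg : g = 0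
    · simp [hg]
    by_cases hh : h = 0
    · simp [hh]
    by_cases hgh : g + h = 0
    · simp [hgh]
    have hdeg : (Algebra.norm F[X] (g + h)).degree ≤
        max (Algebra.norm F[X] g).degree (Algebra.norm F[X] h).degree := by
      obtain ⟨p, q, rfl⟩ := exists_smul_basis_eq g
      obtain ⟨p', q', rfl⟩ := exists_smul_basis_eq h
      have : p • (1 : W.toAffine.CoordinateRing) + q • mk W.toAffine Polynomial.X +
          (p' • 1 + q' • mk W.toAffine Polynomial.X) =
          (p + p') • 1 + (q + q') • mk W.toAffine Polynomial.X := by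
        rw [add_smul, add_smul]; abel
      rw [this]
      simp only [degree_norm_smul_basis]
      have h1 := Polynomial.degree_add_le p p'
      have h2 := Polynomial.degree_add_le q q'
      rcases le_max_iff.1 h1 with h1 | h1 <;> rcases le_max_iff.1 h2 with h2 | h2
      · exact le_max_of_le_left (max_le_max (by gcongr) (by gcongr))
      · exact max_le (le_max_of_le_left (le_max_of_le_left (by gcongr)))
          (le_max_of_le_right (le_max_of_le_right (by gcongr)))
      · exact max_le (le_max_of_le_right (le_max_of_le_left (by gcongr)))
          (le_max_of_le_left (le_max_of_le_right (by gcongr)))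
      · exact le_max_of_le_right (max_le_max (by gcongr) (by gcongr))
    simp only [hg, hh, hgh, if_false]
    rcases le_max_iff.1 hdeg with h1 | h1
    · exact le_max_of_le_left (by simpa using Polynomial.natDegree_le_natDegree h1)
    · exact le_max_of_le_right (by simpa using Polynomial.natDegree_le_natDegree h1)

theorem nonZeroDivisors_le_primeCompl_supp :
    W.toAffine.CoordinateRing⁰ ≤ (infinityValuationAux W).supp.primeCompl :=
  fun g hg h0 => nonZeroDivisors.ne_zero hg (by
    by_contra hne
    rw [SetLike.mem_coe, Valuation.mem_supp_iff] at h0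
    exact WithZero.exp_ne_zero ((if_neg hne).symm.trans h0))

/-- The multiplicative form of the valuation at infinity on the function field. -/
def infinityValuation : Valuation W.toAffine.FunctionField ℤᵐ⁰ :=
  (infinityValuationAux W).extendToLocalization (nonZeroDivisors_le_primeCompl_supp W) _

theorem infinityValuation_algebraMap (g : W.toAffine.CoordinateRing) (hg : g ≠ 0) :
    infinityValuation W (algebraMap _ _ g) =
      WithZero.exp ((Algebra.norm F[X] g).natDegree : ℤ) := by
  rw [infinityValuation, Valuation.extendToLocalization_apply_map_apply]
  exact if_neg hg

theorem infinityValuation_X : infinityValuation W (X W) = WithZero.exp 2 := by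
  have h : mk W.toAffine (Polynomial.C Polynomial.X) =
      (Polynomial.X : F[X]) • (1 : W.toAffine.CoordinateRing) + (0 : F[X]) • mk W.toAffine Polynomial.X := by
    rw [smul, smul]; simp
  have hd := degree_norm_smul_basis (W' := W.toAffine) (Polynomial.X : F[X]) 0
  rw [← h] at hd
  have hn : (Algebra.norm F[X] (mk W.toAffine (Polynomial.C Polynomial.X))).natDegree = 2 :=
    Polynomial.natDegree_eq_of_degree_eq_some (by rw [hd]; simp)
  rw [X, infinityValuation_algebraMap, hn]
  · rfl
  · rintro h0
    rw [h0, Algebra.norm_zero, Polynomial.natDegree_zero] at hn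
    omega

theorem infinityValuation_Y : infinityValuation W (Y W) = WithZero.exp 3 := by
  have h : mk W.toAffine Polynomial.X =
      (0 : F[X]) • (1 : W.toAffine.CoordinateRing) + (1 : F[X]) • mk W.toAffine Polynomial.X := by
    rw [smul, smul]; simp
  have hd := degree_norm_smul_basis (W' := W.toAffine) (0 : F[X]) 1
  rw [← h] at hd
  have hn : (Algebra.norm F[X] (mk W.toAffine Polynomial.X)).natDegree = 3 :=
    Polynomial.natDegree_eq_of_degree_eq_some (by rw [hd]; simp)
  rw [Y, infinityValuation_algebraMap, hn]
  · rfl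
  · rintro h0
    rw [h0, Algebra.norm_zero, Polynomial.natDegree_zero] at hn
    omega

/-- The place `P_∞` at infinity. -/
def infinityPlace : Place F W.toAffine.FunctionField where
  ring := (infinityValuation W).valuationSubring
  algebraMap_mem c := by
    rw [Valuation.mem_valuationSubring_iff]
    by_cases hc : c = 0
    · simp [hc]
    have h : algebraMap F W.toAffine.FunctionField c = algebraMap W.toAffine.CoordinateRing _
        (algebraMap F[X] _ (Polynomial.C c)) := by
      rw [IsScalarTower.algebraMap_apply F W.toAffine.CoordinateRing W.toAffine.FunctionField,
        IsScalarTower.algebraMap_apply F F[X] W.toAffine.CoordinateRing, Polynomial.algebraMap_eq]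
    have hn : (Algebra.norm F[X]
        (algebraMap F[X] W.toAffine.CoordinateRing (Polynomial.C c))).natDegree = 0 := by
      rw [Algebra.norm_algebraMap_of_basis (CoordinateRing.basis W.toAffine)]
      simp
    rw [h, infinityValuation_algebraMap, hn]
    · simp
    · rw [Ne, FaithfulSMul.algebraMap_eq_zero_iff]
      simpa using hc
  isDVR := by
    have : Nontrivial (MonoidWithZeroHom.valueGroup (.ofClass (infinityValuation W))) := by
      rw [Subgroup.nontrivial_iff_exists_ne_one]
      refine ⟨Units.mk0 (infinityValuation W (X W)) (by simp [infinityValuation_X]), ?_, ?_⟩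
      · exact MonoidWithZeroHom.mem_valueGroup _ ⟨X W, rfl⟩
      · intro h1
        have h2 := congrArg Units.val h1
        rw [Units.val_mk0, infinityValuation_X, Units.val_one, ← WithZero.exp_zero,
          WithZero.exp_inj] at h2
        omega
    exact Valuation.valuationSubring_isDiscreteValuationRing _

end Infinity

/-- The rational place attached to a rational point of the curve. -/
def placeOf : W.toAffine.Point → Place F W.toAffine.FunctionField
  | .zero => infinityPlace W
  | .some _ _ h => affinePlace h

variable {W}

/-- The divisor `G = ∑_z t_z ∑_{P ∈ Orb_σ(Q_z)} P`. -/
def orbitDivisor (σ : W.toAffine.FunctionField ≃ₐ[F] W.toAffine.FunctionField) {s : ℕ}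
    (t : Fin s → ℤ) (Q : Fin s → W.toAffine.Point) : Divisor F W.toAffine.FunctionField :=
  ∑ z, t z • ∑ P ∈ (placeOf W (Q z)).orbit σ, Finsupp.single P 1

/-- The function `X^i Y^j / ∏_z [∏_{ρ=1}^{ℓ/2} (X - x(Q_{z,ρ}))]^{t_z}` with `ℓ = ord σ`, where
`Q_{z,ρ} = σ^{ρ-1}(Q_z)`; here `ρ` is shifted to start at `0`. -/
def basisFunction (σ : W.toAffine.FunctionField ≃ₐ[F] W.toAffine.FunctionField) {s : ℕ}
    (t : Fin s → ℤ) (Q : Fin s → W.toAffine.Point) (i j : ℕ) : W.toAffine.FunctionField :=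
  X W ^ i * Y W ^ j /
    ∏ z, (∏ ρ ∈ Finset.range (orderOf σ / 2),
      (X W - algebraMap F _ ((σ ^ ρ • placeOf W (Q z)).value (X W)))) ^ t z

end Curve

end QCElliptic

end

noncomputable section

namespace QCElliptic

open WeierstrassCurve.Affine WeierstrassCurve.Affine.CoordinateRing

/-! ### The coordinate ring of an elliptic curve is a Dedekind domain. -/

section Dedekind

variable {F : Type*} [Field F] {W : WeierstrassCurve F}

/-! Let `D` be the common denominator of the functions in the statement. The vertical line `X -
x(P)` has zeros exactly at `P` and `-P`, simple when these differ, and a double pole at infinity.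
The involution `σ ^ (ℓ / 2)` is negation, so the lines through the first `ℓ / 2` points of an orbit
together vanish once at every point of that orbit. Away from infinity the divisor of `D` is
therefore `G`, and at infinity `D` has a pole of order `ℓ ∑ t_z`, while `G` has coefficient `0`
there.

Consequently `f ∈ L(G)` if and only if `f * D` is regular on the affine curve and has a pole of
order at most `ℓ ∑ t_z` at infinity (`mem_riemannRochSpace_orbitDivisor_iff`). Functions regular at
all places other than infinity form the coordinate ring (`mem_range_algebraMap_iff`), because it is
Dedekind. In that ring `p(X) + q(X) Y` has pole order `max (2 deg p) (2 deg q + 3)`: one term is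
even and the other odd, so leading terms never cancel. Hence the monomials `X ^ i * Y ^ j` with `2 i
+ 3 j ≤ ℓ ∑ t_z` are a basis of the admissible `f * D`, and dividing by `D` gives the theorem,
without the Riemann–Roch theorem.

The group theory enters through the freeness of the orbits (`pow_smul_placeOf_ne`). An automorphism
fixing infinity preserves pole orders there, so it acts by `X ↦ aX + b`, `Y ↦ cY + dX + e`.
Comparing coefficients in the Weierstrass equation shows that an element of order 2 is negation, and
that an affine fixed point of an element of order 3 is 2-torsion or 3-torsion. Points outside `E[2]
∪ E[3]` thus have orbits of full length. -/

theorem equation_mk_C_X_mk_Y :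
    mk W.toAffine Polynomial.X ^ 2 +
        algebraMap F W.toAffine.CoordinateRing W.a₁ * mk W.toAffine (Polynomial.C Polynomial.X) *
          mk W.toAffine Polynomial.X +
        algebraMap F W.toAffine.CoordinateRing W.a₃ * mk W.toAffine Polynomial.X =
      mk W.toAffine (Polynomial.C Polynomial.X) ^ 3 +
        algebraMap F W.toAffine.CoordinateRing W.a₂ *
          mk W.toAffine (Polynomial.C Polynomial.X) ^ 2 +
        algebraMap F W.toAffine.CoordinateRing W.a₄ * mk W.toAffine (Polynomial.C Polynomial.X) +
        algebraMap F W.toAffine.CoordinateRing W.a₆ := by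
  have h : ∀ c : F, algebraMap F W.toAffine.CoordinateRing c =
      mk W.toAffine (Polynomial.C (Polynomial.C c)) := fun c => rfl
  have h0 : mk W.toAffine (Polynomial.X ^ 2 +
      Polynomial.C (Polynomial.C W.a₁ * Polynomial.X + Polynomial.C W.a₃) * Polynomial.X -
      Polynomial.C (Polynomial.X ^ 3 + Polynomial.C W.a₂ * Polynomial.X ^ 2 +
        Polynomial.C W.a₄ * Polynomial.X + Polynomial.C W.a₆)) = 0 := AdjoinRoot.mk_self
  simp only [map_add, map_sub, map_mul, map_pow] at h0
  simp only [h]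
  linear_combination h0

theorem pointIdeal_eq_span {a b : F} (h : W.toAffine.Nonsingular a b) :
    pointIdeal h = Ideal.span
      {mk W.toAffine (Polynomial.C Polynomial.X) - algebraMap F W.toAffine.CoordinateRing a,
        mk W.toAffine Polynomial.X - algebraMap F W.toAffine.CoordinateRing b} := by
  rw [pointIdeal, XYIdeal, XClass, YClass]
  simp only [map_sub]
  rfl

/-- Modulo `I` the coordinates become the constants `a` and `b`, so the defect of the Weierstrass
equation at `(a, b)` is a constant lying in `I`; a nonzero one would be a unit. -/
theorem equation_of_mem_ideal {I : Ideal W.toAffine.CoordinateRing} (hI : I ≠ ⊤) {a b : F}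
    (ha : mk W.toAffine (Polynomial.C Polynomial.X) - algebraMap F W.toAffine.CoordinateRing a ∈ I)
    (hb : mk W.toAffine Polynomial.X - algebraMap F W.toAffine.CoordinateRing b ∈ I) :
    W.toAffine.Equation a b := by
  rw [WeierstrassCurve.Affine.equation_iff']
  by_contra hne
  refine hI (Ideal.eq_top_of_isUnit_mem I (x := algebraMap F W.toAffine.CoordinateRing
    (b ^ 2 + W.a₁ * a * b + W.a₃ * b - (a ^ 3 + W.a₂ * a ^ 2 + W.a₄ * a + W.a₆))) ?_
    ((Ne.isUnit hne).map _))
  have he := equation_mk_C_X_mk_Y (W := W)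
  rw [← Ideal.Quotient.eq_zero_iff_mem] at ha hb ⊢
  rw [map_sub, sub_eq_zero] at ha hb
  replace he := congrArg (Ideal.Quotient.mk I) he
  simp only [map_add, map_sub, map_mul, map_pow, ha, hb] at he ⊢
  linear_combination he

theorem eq_pointIdeal_of_mem {m : Ideal W.toAffine.CoordinateRing} (hm : m ≠ ⊤) {a b : F}
    (h : W.toAffine.Nonsingular a b)
    (ha : mk W.toAffine (Polynomial.C Polynomial.X) - algebraMap F W.toAffine.CoordinateRing a ∈ m)
    (hb : mk W.toAffine Polynomial.X - algebraMap F W.toAffine.CoordinateRing b ∈ m) :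
    m = pointIdeal h := by
  have hmax : (pointIdeal h).IsMaximal := inferInstance
  refine (hmax.eq_of_le hm ?_).symm
  rw [pointIdeal_eq_span, Ideal.span_le, Set.insert_subset_iff, Set.singleton_subset_iff]
  exact ⟨ha, hb⟩

instance : Algebra.FiniteType F W.toAffine.CoordinateRing :=
  Algebra.FiniteType.trans (S := F[X]) inferInstance inferInstance

/-- Nullstellensatz: the residue field is finite over `F`, hence equal to `F`, and the residues of
`X` and `Y` are the coordinates of the point. -/
theorem exists_eq_pointIdeal_of_isAlgClosed [IsAlgClosed F] [W.IsElliptic]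
    (m : Ideal W.toAffine.CoordinateRing) [hm : m.IsMaximal] :
    ∃ (a b : F) (h : W.toAffine.Nonsingular a b), m = pointIdeal h := by
  let := Ideal.Quotient.field m
  have : Algebra.FiniteType F (W.toAffine.CoordinateRing ⧸ m) :=
    Algebra.FiniteType.of_surjective (Ideal.Quotient.mkₐ F m) (Ideal.Quotient.mkₐ_surjective F m)
  have : Module.Finite F (W.toAffine.CoordinateRing ⧸ m) := finite_of_finite_type_of_isJacobsonRing _ _
  have hs : Function.Surjective (algebraMap F (W.toAffine.CoordinateRing ⧸ m)) :=
    IsAlgClosed.algebraMap_bijective_of_isIntegral.2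
  obtain ⟨a, ha⟩ := hs (Ideal.Quotient.mk m (mk W.toAffine (Polynomial.C Polynomial.X)))
  obtain ⟨b, hb⟩ := hs (Ideal.Quotient.mk m (mk W.toAffine Polynomial.X))
  have ha' : mk W.toAffine (Polynomial.C Polynomial.X) -
      algebraMap F W.toAffine.CoordinateRing a ∈ m := by
    rw [← Ideal.Quotient.eq_zero_iff_mem, map_sub, ← ha]
    exact sub_self _
  have hb' : mk W.toAffine Polynomial.X - algebraMap F W.toAffine.CoordinateRing b ∈ m := by
    rw [← Ideal.Quotient.eq_zero_iff_mem, map_sub, ← hb]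
    exact sub_self _
  have h : W.toAffine.Nonsingular a b := WeierstrassCurve.Affine.equation_iff_nonsingular.1
    (equation_of_mem_ideal hm.ne_top ha' hb')
  exact ⟨a, b, h, eq_pointIdeal_of_mem hm.ne_top h ha' hb'⟩

theorem isIntegrallyClosed_of_isAlgClosed [IsAlgClosed F] [W.IsElliptic] :
    IsIntegrallyClosed W.toAffine.CoordinateRing := by
  refine IsIntegrallyClosed.of_localization_maximal fun p hp hpm => ?_
  obtain ⟨a, b, h, rfl⟩ := exists_eq_pointIdeal_of_isAlgClosed p
  exact .of_equiv (IsLocalization.algEquiv (pointIdeal h).primeCompl (localRing h)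
    (Localization.AtPrime (pointIdeal h))).toRingEquiv

/-- The cofactor is the conjugate of `g` under `Y ↦ -Y - a₁X - a₃`, and the product is the norm.
This lets denominators be taken in `F[X]`. -/
theorem exists_mul_eq_algebraMap_ne_zero {g : W.toAffine.CoordinateRing} (hg : g ≠ 0) :
    ∃ (g' : W.toAffine.CoordinateRing) (p : F[X]), p ≠ 0 ∧ g * g' = algebraMap F[X] _ p := by
  obtain ⟨p, q, rfl⟩ := exists_smul_basis_eq g
  refine ⟨mk W.toAffine (Polynomial.C p + Polynomial.C q * (-Polynomial.X -
    Polynomial.C (Polynomial.C W.a₁ * Polynomial.X + Polynomial.C W.a₃))),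
    Algebra.norm F[X] (p • (1 : W.toAffine.CoordinateRing) + q • mk W.toAffine Polynomial.X),
    Algebra.norm_ne_zero_iff.2 hg, ?_⟩
  have := coe_norm_smul_basis (W' := W.toAffine) p q
  rw [smul, smul, mul_one, ← map_mul, ← map_add, ← map_mul]
  rw [smul, smul, mul_one, ← map_mul, ← map_add] at this
  exact this.symm

/-- Since `1, Y` is a basis over the polynomial ring before and after base change, divisibility by
`d` is tested on coordinates, where it descends along field extensions. -/
theorem algebraMap_dvd_of_map_dvd_map {F' : Type*} [Field F'] (f : F →+* F') {d : F[X]}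
    {g : W.toAffine.CoordinateRing}
    (h : CoordinateRing.map W.toAffine f (algebraMap F[X] _ d) ∣ CoordinateRing.map W.toAffine f g) :
    algebraMap F[X] _ d ∣ g := by
  obtain ⟨y, hmul⟩ := h
  obtain ⟨p, q, rfl⟩ := exists_smul_basis_eq g
  obtain ⟨p', q', rfl⟩ := exists_smul_basis_eq y
  rw [Algebra.algebraMap_eq_smul_one, map_add, CoordinateRing.map_smul, CoordinateRing.map_smul,
    CoordinateRing.map_smul, map_one, map_mk, Polynomial.map_X, smul_mul_assoc, one_mul,
    smul_add] at hmul
  have hz : (d.map f * p' - p.map f) • (1 : (W.toAffine.map f).CoordinateRing) +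
      (d.map f * q' - q.map f) • mk (W.toAffine.map f) Polynomial.X = 0 := by
    simp only [sub_smul, mul_smul]
    linear_combination -hmul
  obtain ⟨hp, hq⟩ := smul_basis_eq_zero hz
  obtain ⟨p₁, rfl⟩ : d ∣ p := (Polynomial.map_dvd_map' f).1 ⟨p', (sub_eq_zero.1 hp).symm⟩
  obtain ⟨q₁, rfl⟩ : d ∣ q := (Polynomial.map_dvd_map' f).1 ⟨q', (sub_eq_zero.1 hq).symm⟩
  refine ⟨p₁ • 1 + q₁ • mk W.toAffine Polynomial.X, ?_⟩
  rw [Algebra.algebraMap_eq_smul_one, smul_mul_assoc, one_mul, smul_add, mul_smul, mul_smul]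

theorem IsIntegrallyClosed.dvd_map_of_isIntegral_div {A B K L : Type*} [CommRing A] [IsDomain A]
    [CommRing B] [IsDomain B] [IsIntegrallyClosed B] [Field K] [Algebra A K] [IsFractionRing A K]
    [Field L] [Algebra B L] [IsFractionRing B L] {φ : A →+* B} (hφ : Function.Injective φ)
    {g h : A} (hh : h ≠ 0) (hx : IsIntegral A (algebraMap A K g / algebraMap A K h)) :
    φ h ∣ φ g := by
  set ψ : K →+* L := IsFractionRing.map hφ with hψ
  have hψφ : ∀ g, ψ (algebraMap A K g) = algebraMap B L (φ g) := fun g => IsLocalization.map_eq _ g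
  obtain ⟨y, hy⟩ := (isIntegrallyClosed_iff L).1 inferInstance
    (hx.map_of_comp_eq φ ψ (RingHom.ext fun g => (hψφ g).symm))
  refine ⟨y, IsFractionRing.injective B L ?_⟩
  rw [map_mul, hy, ← hψφ, ← hψφ, ← map_mul, mul_div_cancel₀]
  simpa using hh

/-- Not every maximal ideal comes from an `F`-rational point, so the argument passes to the
algebraic closure, where all local rings are discrete valuation rings. Once the denominator is a
polynomial in `X`, the resulting divisibility descends to `F`. -/
instance isIntegrallyClosed_coordinateRing [W.IsElliptic] :
    IsIntegrallyClosed W.toAffine.CoordinateRing := by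
  have hcl : IsIntegrallyClosed
      (W.toAffine.map (algebraMap F (AlgebraicClosure F))).CoordinateRing :=
    isIntegrallyClosed_of_isAlgClosed (W := W.map (algebraMap F (AlgebraicClosure F)))
  rw [isIntegrallyClosed_iff W.toAffine.FunctionField]
  intro x hx
  obtain ⟨g, h, hh, rfl⟩ := IsFractionRing.div_surjective (A := W.toAffine.CoordinateRing) x
  obtain ⟨h', d, hd, hhd⟩ := exists_mul_eq_algebraMap_ne_zero (nonZeroDivisors.ne_zero hh)
  have hd' : algebraMap F[X] W.toAffine.CoordinateRing d ≠ 0 := by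
    rwa [Ne, FaithfulSMul.algebraMap_eq_zero_iff]
  have hd'' := hd'
  rw [← hhd] at hd''
  have hK : ∀ {y : W.toAffine.CoordinateRing}, y ≠ 0 →
      algebraMap _ W.toAffine.FunctionField y ≠ 0 := fun hy => by
    rwa [Ne, FaithfulSMul.algebraMap_eq_zero_iff]
  have hx' : algebraMap _ W.toAffine.FunctionField g / algebraMap _ _ h =
      algebraMap _ _ (g * h') / algebraMap _ _ (algebraMap F[X] W.toAffine.CoordinateRing d) := by
    rw [← hhd, map_mul, map_mul, mul_div_mul_right _ _ (hK (right_ne_zero_of_mul hd''))]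
  rw [hx'] at hx ⊢
  obtain ⟨y, hy⟩ := algebraMap_dvd_of_map_dvd_map (algebraMap F (AlgebraicClosure F))
    (IsIntegrallyClosed.dvd_map_of_isIntegral_div
      (L := (W.toAffine.map (algebraMap F (AlgebraicClosure F))).FunctionField)
      (map_injective (algebraMap F (AlgebraicClosure F)).injective) hd' hx)
  exact ⟨y, by rw [hy, map_mul, mul_div_cancel_left₀ _ (hK hd')]⟩

instance isDedekindDomain_coordinateRing [W.IsElliptic] :
    IsDedekindDomain W.toAffine.CoordinateRing where
  __ := Ring.DimensionLEOne.of_isIntegral F[X] W.toAffine.CoordinateRing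
  __ := isIntegrallyClosed_coordinateRing

end Dedekind

end QCElliptic

namespace QCElliptic

open WeierstrassCurve.Affine WeierstrassCurve.Affine.CoordinateRing

/-! ### Places, their valuations and the action of automorphisms. -/

section PlaceBasics

variable {k K : Type*} [Field k] [Field K] [Algebra k K]

namespace Place

theorem valuation_le_one_iff (P : Place k K) (f : K) : P.valuation f ≤ 1 ↔ f ∈ P.ring := by
  refine ⟨fun h => ?_, fun h =>
    (IsDiscreteValuationRing.maximalIdeal P.ring).valuation_le_one (⟨f, h⟩ : P.ring)⟩
  rcases eq_or_ne f 0 with rfl | hf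
  · exact zero_mem _
  rcases P.ring.mem_or_inv_mem f with hm | hm
  · exact hm
  have h1 : P.valuation f⁻¹ = 1 := by
    refine le_antisymm ((IsDiscreteValuationRing.maximalIdeal P.ring).valuation_le_one
      (⟨f⁻¹, hm⟩ : P.ring)) ?_
    rw [map_inv₀]
    exact (one_le_inv₀ (zero_lt_iff.2 ((Valuation.ne_zero_iff _).2 hf))).2 h
  -- If only `f⁻¹` is known to be in the ring, its valuation is forced to be 1; it is then a unit,
  -- so its inverse `f` is in the ring after all.
  have h2 : (⟨f⁻¹, hm⟩ : P.ring) ∉ IsLocalRing.maximalIdeal P.ring := fun hmem =>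
    h1.not_lt (((IsDiscreteValuationRing.maximalIdeal P.ring).valuation_lt_one_iff_mem
      (⟨f⁻¹, hm⟩ : P.ring)).2 hmem)
  obtain ⟨u, hu⟩ := not_not.1 h2
  have h3 : f = ((u⁻¹ : P.ringˣ) : P.ring) := by
    have h4 : ((u : P.ring) : K) * ((u⁻¹ : P.ringˣ) : P.ring) = 1 := by
      rw [← MulMemClass.coe_mul, Units.mul_inv, OneMemClass.coe_one]
    rw [hu] at h4
    exact (inv_mul_eq_one₀ hf).1 h4
  rw [h3]
  exact SetLike.coe_mem _

/-- A valuation ring of dimension at most one has no proper overring in `K` except `K`, and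
`P'.ring` is not `K` because it has a uniformizer. Places can thus be identified from one inclusion.
-/
theorem eq_of_ring_le {P P' : Place k K} (h : P.ring ≤ P'.ring) : P = P' := by
  have : Ring.KrullDimLE 1 P.ring := Ring.KrullDimLE.mk₁' fun _ h _ =>
    IsPrime.to_maximal_ideal h
  refine Place.ext (ValuationSubring.eq_of_le_of_ne_top P.ring h fun htop => ?_)
  obtain ⟨π, hπ⟩ := IsDiscreteValuationRing.exists_irreducible P'.ring
  have hπ0 : (π : K) ≠ 0 := fun h0 => hπ.ne_zero (Subtype.ext h0)
  have hmem : (π : K)⁻¹ ∈ P'.ring := htop.ge (ValuationSubring.mem_top _)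
  exact hπ.not_isUnit (IsUnit.of_mul_eq_one (⟨_, hmem⟩ : P'.ring)
    (Subtype.ext (mul_inv_cancel₀ hπ0)))

theorem valuation_algebraMap (P : Place k K) {c : k} (hc : c ≠ 0) :
    P.valuation (algebraMap k K c) = 1 := by
  refine le_antisymm (P.valuation_algebraMap_le_one c) ?_
  have h := P.valuation_algebraMap_le_one c⁻¹
  rw [map_inv₀, map_inv₀] at h
  refine (inv_le_one₀ (zero_lt_iff.2 ((Valuation.ne_zero_iff _).2 ?_))).1 h
  simpa using hc

theorem valuation_algebraMap_lt_one_iff (P : Place k K) {c : k} :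
    P.valuation (algebraMap k K c) < 1 ↔ c = 0 := by
  refine ⟨fun h => ?_, fun h => by simp [h]⟩
  by_contra hc
  exact h.ne (P.valuation_algebraMap hc)

instance (P : Place k K) : P.valuation.IsTrivialOn k := ⟨fun _ hc => P.valuation_algebraMap hc⟩

/-- Two admissible constants differ by a constant of valuation below 1, that is by zero, so the
arbitrary choice in `value` is harmless. -/
theorem value_eq (P : Place k K) {f : K} {c : k} (h : P.valuation (f - algebraMap k K c) < 1) :
    P.value f = c := by
  have h2 : P.valuation (f - algebraMap k K (P.value f)) < 1 :=
    Classical.epsilon_spec (p := fun c => P.valuation (f - algebraMap k K c) < 1) ⟨c, h⟩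
  rw [← sub_eq_zero, ← P.valuation_algebraMap_lt_one_iff]
  have h3 : algebraMap k K (P.value f - c) =
      (f - algebraMap k K c) - (f - algebraMap k K (P.value f)) := by
    rw [map_sub]; ring
  rw [h3]
  exact (P.valuation.map_sub _ _).trans_lt (max_lt h h2)

theorem degree_eq_one (P : Place k K)
    (h : ∀ f ∈ P.ring, ∃ c : k, P.valuation (f - algebraMap k K c) < 1) : P.degree = 1 := by
  refine finrank_eq_one_iff_of_nonzero' (1 : IsLocalRing.ResidueField P.ring) one_ne_zero |>.2 ?_
  intro w
  obtain ⟨f, rfl⟩ := IsLocalRing.residue_surjective w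
  obtain ⟨c, hc⟩ := h f f.2
  refine ⟨c, ?_⟩
  rw [← Algebra.algebraMap_eq_smul_one]
  have h1 : f - algebraMap k P.ring c ∈ IsLocalRing.maximalIdeal P.ring :=
    ((IsDiscreteValuationRing.maximalIdeal P.ring).valuation_lt_one_iff_mem (K := K) _).1 hc
  rw [← IsLocalRing.residue_eq_zero_iff, map_sub, sub_eq_zero] at h1
  exact h1.symm

theorem mem_smul_ring_iff (σ : K ≃ₐ[k] K) (P : Place k K) (f : K) :
    f ∈ (σ • P).ring ↔ σ.symm f ∈ P.ring := by
  change f ∈ σ • P.ring ↔ _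
  rw [ValuationSubring.mem_pointwise_smul_iff_inv_smul_mem]
  rfl

instance : MulAction (K ≃ₐ[k] K) (Place k K) where
  one_smul P := Place.ext (one_smul _ P.ring)
  mul_smul σ τ P := Place.ext (mul_smul σ τ P.ring)

theorem valuation_smul_lt_one_iff (σ : K ≃ₐ[k] K) (P : Place k K) (f : K) :
    (σ • P).valuation f < 1 ↔ P.valuation (σ.symm f) < 1 := by
  rcases eq_or_ne f 0 with rfl | hf
  · simp
  rw [← not_iff_not, not_lt, not_lt]
  have key : ∀ (P : Place k K) {x : K}, x ≠ 0 → (1 ≤ P.valuation x ↔ P.valuation x⁻¹ ≤ 1) :=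
    fun P x hx => by
      rw [map_inv₀, inv_le_one₀ (zero_lt_iff.2 ((Valuation.ne_zero_iff _).2 hx))]
  rw [key _ hf, key P (by simpa using hf), valuation_le_one_iff, valuation_le_one_iff,
    mem_smul_ring_iff, map_inv₀]

end Place

end PlaceBasics

/-! ### Places at which `X` is regular, and affine rational points. -/

section CurvePlaces

variable {F : Type*} [Field F] {W : WeierstrassCurve F}

theorem equation_X_Y :
    Y W ^ 2 + algebraMap F _ W.a₁ * X W * Y W + algebraMap F _ W.a₃ * Y W =
      X W ^ 3 + algebraMap F _ W.a₂ * X W ^ 2 + algebraMap F _ W.a₄ * X W +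
        algebraMap F W.toAffine.FunctionField W.a₆ := by
  have h := congrArg (algebraMap W.toAffine.CoordinateRing W.toAffine.FunctionField)
    (equation_mk_C_X_mk_Y (W := W))
  simp only [map_add, map_mul, map_pow, ← IsScalarTower.algebraMap_apply] at h
  exact h

theorem algebraMap_mk_C (p : F[X]) :
    algebraMap W.toAffine.CoordinateRing W.toAffine.FunctionField (mk W.toAffine (Polynomial.C p)) =
      Polynomial.aeval (X W) p := by
  have h : ((algebraMap W.toAffine.CoordinateRing W.toAffine.FunctionField).comp
      ((mk W.toAffine).comp Polynomial.C)) = (Polynomial.aeval (R := F) (X W)).toRingHom := by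
    refine Polynomial.ringHom_ext (fun c => ?_) ?_
    · simp only [AlgHom.toRingHom_eq_coe, RingHom.coe_coe, Polynomial.aeval_C]
      rw [IsScalarTower.algebraMap_apply F W.toAffine.CoordinateRing W.toAffine.FunctionField]
      rfl
    · simp only [AlgHom.toRingHom_eq_coe, RingHom.coe_coe, Polynomial.aeval_X]
      rfl
  exact congrArg (fun φ : F[X] →+* W.toAffine.FunctionField => φ p) h

theorem algebraMap_smul_basis (p q : F[X]) :
    algebraMap W.toAffine.CoordinateRing W.toAffine.FunctionField
        (p • (1 : W.toAffine.CoordinateRing) + q • mk W.toAffine Polynomial.X) =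
      Polynomial.aeval (X W) p + Polynomial.aeval (X W) q * Y W := by
  rw [smul, smul, mul_one, map_add, map_mul, algebraMap_mk_C, algebraMap_mk_C]
  rfl

theorem Place.algebraMap_mem_ring {P : Place F W.toAffine.FunctionField} (hX : X W ∈ P.ring)
    (g : W.toAffine.CoordinateRing) : algebraMap _ W.toAffine.FunctionField g ∈ P.ring := by
  have hp : ∀ p : F[X], Polynomial.aeval (X W) p ∈ P.ring := fun p => by
    rw [Polynomial.aeval_eq_sum_range]
    refine sum_mem fun i _ => ?_
    rw [Algebra.smul_def]
    exact mul_mem (P.algebraMap_mem _) (pow_mem hX _)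
  have hY : Y W ∈ P.ring := by
    rw [← P.valuation_le_one_iff]
    by_contra! hlt
    -- `Y` is integral over `F[X]`: this product is a cubic in `X`, yet a pole of `Y` would make
    -- both factors have poles.
    have hy : P.valuation (Y W * (Y W + (algebraMap F _ W.a₁ * X W + algebraMap F _ W.a₃))) ≤ 1 := by
      have h : Y W * (Y W + (algebraMap F _ W.a₁ * X W + algebraMap F _ W.a₃)) =
          Polynomial.aeval (X W) (Polynomial.X ^ 3 + Polynomial.C W.a₂ * Polynomial.X ^ 2 +
            Polynomial.C W.a₄ * Polynomial.X + Polynomial.C W.a₆) := by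
        simp only [map_add, map_mul, map_pow, Polynomial.aeval_C, Polynomial.aeval_X]
        linear_combination equation_X_Y (W := W)
      rw [h, P.valuation_le_one_iff]
      exact hp _
    have hl : P.valuation (algebraMap F _ W.a₁ * X W + algebraMap F _ W.a₃) ≤ 1 := by
      rw [P.valuation_le_one_iff]
      exact add_mem (mul_mem (P.algebraMap_mem _) hX) (P.algebraMap_mem _)
    rw [map_mul, Valuation.map_add_eq_of_lt_left _ (hl.trans_lt hlt)] at hy
    exact hy.not_gt (one_lt_mul'' hlt hlt)
  obtain ⟨p, q, rfl⟩ := exists_smul_basis_eq g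
  rw [algebraMap_smul_basis]
  exact add_mem (hp p) (mul_mem (hp q) hY)

/-- The ideal of the regular functions that vanish at a place. -/
def Place.center (P : Place F W.toAffine.FunctionField) (hX : X W ∈ P.ring) :
    Ideal W.toAffine.CoordinateRing where
  carrier := {g | P.valuation (algebraMap _ _ g) < 1}
  zero_mem' := by simp
  add_mem' {f g} hf hg := by
    simp only [Set.mem_ofPred_eq, map_add] at *
    exact P.valuation.map_add_lt hf hg
  smul_mem' c g hg := by
    simp only [Set.mem_ofPred_eq, smul_eq_mul, map_mul] at *
    exact (mul_le_of_le_one_left' ((P.valuation_le_one_iff _).2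
      (P.algebraMap_mem_ring hX c))).trans_lt hg

theorem Place.mem_center {P : Place F W.toAffine.FunctionField} {hX : X W ∈ P.ring}
    {g : W.toAffine.CoordinateRing} :
    g ∈ P.center hX ↔ P.valuation (algebraMap _ W.toAffine.FunctionField g) < 1 := Iff.rfl

theorem Place.isPrime_center (P : Place F W.toAffine.FunctionField) (hX : X W ∈ P.ring) :
    (P.center hX).IsPrime where
  ne_top' := by
    rw [Ideal.ne_top_iff_one, Place.mem_center]
    simp
  mem_or_mem' {f g} h := by
    rw [Place.mem_center, map_mul, map_mul] at h
    rw [Place.mem_center, Place.mem_center]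
    by_contra! hcon
    exact h.not_ge (one_le_mul hcon.1 hcon.2)

theorem algebraMap_mk_C_X_sub (a : F) :
    algebraMap W.toAffine.CoordinateRing W.toAffine.FunctionField
      (mk W.toAffine (Polynomial.C Polynomial.X) - algebraMap F _ a) = X W - algebraMap F _ a := by
  rw [map_sub, ← IsScalarTower.algebraMap_apply]
  rfl

theorem algebraMap_mk_Y_sub (b : F) :
    algebraMap W.toAffine.CoordinateRing W.toAffine.FunctionField
      (mk W.toAffine Polynomial.X - algebraMap F _ b) = Y W - algebraMap F _ b := by
  rw [map_sub, ← IsScalarTower.algebraMap_apply]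
  rfl

theorem mem_affinePlace_ring_iff {a b : F} (h : W.toAffine.Nonsingular a b)
    (f : W.toAffine.FunctionField) : f ∈ (affinePlace h).ring ↔
      ∃ (g s : W.toAffine.CoordinateRing) (_ : s ∈ (pointIdeal h).primeCompl),
        f = algebraMap _ _ g * (algebraMap _ _ s)⁻¹ := Iff.rfl

theorem algebraMap_mem_affinePlace_ring {a b : F} (h : W.toAffine.Nonsingular a b)
    (g : W.toAffine.CoordinateRing) :
    algebraMap _ W.toAffine.FunctionField g ∈ (affinePlace h).ring :=
  (mem_affinePlace_ring_iff h _).2 ⟨g, 1, one_mem _, by simp⟩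

theorem X_mem_affinePlace_ring {a b : F} (h : W.toAffine.Nonsingular a b) :
    X W ∈ (affinePlace h).ring := algebraMap_mem_affinePlace_ring h _

theorem affinePlace_valuation_lt_one_iff {a b : F} (h : W.toAffine.Nonsingular a b)
    (g : W.toAffine.CoordinateRing) :
    (affinePlace h).valuation (algebraMap _ W.toAffine.FunctionField g) < 1 ↔ g ∈ pointIdeal h := by
  rcases eq_or_ne g 0 with rfl | hg
  · simp
  have hg' : algebraMap _ W.toAffine.FunctionField g ≠ 0 := by
    rwa [Ne, FaithfulSMul.algebraMap_eq_zero_iff]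
  rw [← not_iff_not, not_lt, ← inv_le_one₀ (zero_lt_iff.2 ((Valuation.ne_zero_iff _).2 hg')),
    ← map_inv₀, Place.valuation_le_one_iff, mem_affinePlace_ring_iff]
  constructor
  · rintro ⟨c, s, hs, he⟩ hgm
    have hs0 : algebraMap _ W.toAffine.FunctionField s ≠ 0 := by
      rw [Ne, FaithfulSMul.algebraMap_eq_zero_iff]
      rintro rfl
      exact hs (zero_mem _)
    refine hs ?_
    have : s = c * g := by
      apply IsFractionRing.injective W.toAffine.CoordinateRing W.toAffine.FunctionField
      rw [map_mul]
      field_simp at he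
      rw [he, mul_comm]
    rw [this]
    exact Ideal.mul_mem_left _ _ hgm
  · intro hgm
    exact ⟨1, g, hgm, by simp⟩

theorem affinePlace_valuation_X_sub_lt_one {a b : F} (h : W.toAffine.Nonsingular a b) :
    (affinePlace h).valuation (X W - algebraMap F _ a) < 1 := by
  rw [← algebraMap_mk_C_X_sub, affinePlace_valuation_lt_one_iff, pointIdeal_eq_span]
  exact Ideal.subset_span (Set.mem_insert _ _)

theorem affinePlace_valuation_Y_sub_lt_one {a b : F} (h : W.toAffine.Nonsingular a b) :
    (affinePlace h).valuation (Y W - algebraMap F _ b) < 1 := by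
  rw [← algebraMap_mk_Y_sub, affinePlace_valuation_lt_one_iff, pointIdeal_eq_span]
  exact Ideal.subset_span (Set.mem_insert_of_mem _ rfl)

/-- Regular functions outside the center are units at `P`, so `P.ring` contains the local ring of
the point; `Place.eq_of_ring_le` turns this inclusion into equality. -/
theorem eq_affinePlace_of_center {P : Place F W.toAffine.FunctionField} (hX : X W ∈ P.ring)
    {a b : F} (h : W.toAffine.Nonsingular a b) (hc : P.center hX = pointIdeal h) :
    P = affinePlace h := by
  refine (Place.eq_of_ring_le fun f hf => ?_).symm
  obtain ⟨g, s, hs, rfl⟩ := (mem_affinePlace_ring_iff h f).1 hf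
  refine mul_mem (P.algebraMap_mem_ring hX g) ?_
  have hs' : ¬ P.valuation (algebraMap _ W.toAffine.FunctionField s) < 1 := by
    rw [← Place.mem_center (hX := hX), hc]
    exact hs
  rw [← P.valuation_le_one_iff, map_inv₀]
  exact inv_le_one_of_one_le₀ (not_lt.1 hs')

theorem Place.X_mem_ring_of_valuation_sub {P : Place F W.toAffine.FunctionField} {a : F}
    (ha : P.valuation (X W - algebraMap F _ a) < 1) : X W ∈ P.ring := by
  have := add_mem ((P.valuation_le_one_iff _).1 ha.le) (P.algebraMap_mem a)
  rwa [sub_add_cancel] at this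

theorem equation_of_valuation_lt_one {P : Place F W.toAffine.FunctionField} {a b : F}
    (ha : P.valuation (X W - algebraMap F _ a) < 1)
    (hb : P.valuation (Y W - algebraMap F _ b) < 1) : W.toAffine.Equation a b := by
  have hX := Place.X_mem_ring_of_valuation_sub ha
  refine equation_of_mem_ideal (P.isPrime_center hX).ne_top ?_ ?_
  · rwa [Place.mem_center, algebraMap_mk_C_X_sub]
  · rwa [Place.mem_center, algebraMap_mk_Y_sub]

theorem eq_affinePlace_of_valuation_lt_one {P : Place F W.toAffine.FunctionField} {a b : F}
    (h : W.toAffine.Nonsingular a b)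
    (ha : P.valuation (X W - algebraMap F _ a) < 1)
    (hb : P.valuation (Y W - algebraMap F _ b) < 1) : P = affinePlace h := by
  have hX := Place.X_mem_ring_of_valuation_sub ha
  refine eq_affinePlace_of_center hX h (eq_pointIdeal_of_mem (P.isPrime_center hX).ne_top h ?_ ?_)
  · rwa [Place.mem_center, algebraMap_mk_C_X_sub]
  · rwa [Place.mem_center, algebraMap_mk_Y_sub]

theorem degree_affinePlace {a b : F} (h : W.toAffine.Nonsingular a b) :
    (affinePlace h).degree = 1 := by
  have hcong : ∀ g : W.toAffine.CoordinateRing, ∃ c : F, g - algebraMap F _ c ∈ pointIdeal h := by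
    intro g
    have e := quotientXYIdealEquiv (W' := W.toAffine) (x := a) (y := Polynomial.C b)
      (by simpa [WeierstrassCurve.Affine.Equation, Polynomial.evalEval] using h.1)
    refine ⟨e (Ideal.Quotient.mk _ g), ?_⟩
    have h1 := e.symm.commutes (e (Ideal.Quotient.mk _ g))
    rw [Algebra.algebraMap_self, RingHom.id_apply, AlgEquiv.symm_apply_apply] at h1
    rw [← Ideal.Quotient.eq_zero_iff_mem, map_sub, sub_eq_zero]
    exact h1
  refine Place.degree_eq_one _ fun f hf => ?_
  obtain ⟨g, s, hs, rfl⟩ := (mem_affinePlace_ring_iff h f).1 hf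
  obtain ⟨c, hc⟩ := hcong g
  obtain ⟨d, hd⟩ := hcong s
  have hd0 : d ≠ 0 := by
    rintro rfl
    rw [map_zero, sub_zero] at hd
    exact hs hd
  have hs1 : (affinePlace h).valuation (algebraMap _ W.toAffine.FunctionField s) = 1 :=
    le_antisymm ((Place.valuation_le_one_iff _ _).2 (algebraMap_mem_affinePlace_ring h s))
      (not_lt.1 (mt (affinePlace_valuation_lt_one_iff h s).1 hs))
  have hs0 : algebraMap _ W.toAffine.FunctionField s ≠ 0 := by
    rw [← Valuation.ne_zero_iff (affinePlace h).valuation, hs1]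
    exact one_ne_zero
  -- With `c` and `d` the values of `g` and `s` at the point, the value of `g / s` is `c / d`.
  have hmem : g - algebraMap F _ (c / d) * s ∈ pointIdeal h := by
    have : g - algebraMap F _ (c / d) * s =
        (g - algebraMap F _ c) - algebraMap F _ (c / d) * (s - algebraMap F _ d) := by
      have h2 : algebraMap F W.toAffine.CoordinateRing c =
          algebraMap F _ (c / d) * algebraMap F _ d := by
        rw [← map_mul, div_mul_cancel₀ _ hd0]
      rw [h2]; ring
    rw [this]
    exact sub_mem hc (Ideal.mul_mem_left _ _ hd)
  refine ⟨c / d, ?_⟩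
  have he : algebraMap _ W.toAffine.FunctionField g * (algebraMap _ _ s)⁻¹ -
      algebraMap F _ (c / d) =
      algebraMap _ _ (g - algebraMap F _ (c / d) * s) * (algebraMap _ _ s)⁻¹ := by
    rw [map_sub, map_mul, ← IsScalarTower.algebraMap_apply]
    field_simp
  rw [he, map_mul, map_inv₀, hs1, inv_one, mul_one, affinePlace_valuation_lt_one_iff]
  exact hmem

end CurvePlaces

end QCElliptic

namespace QCElliptic

open WeierstrassCurve.Affine WeierstrassCurve.Affine.CoordinateRing

/-! ### The place at infinity is the only pole of `X`. -/

section InfinityPlace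

variable {F : Type*} [Field F] {W : WeierstrassCurve F}

theorem mem_infinityPlace_ring_iff (f : W.toAffine.FunctionField) :
    f ∈ (infinityPlace W).ring ↔ infinityValuation W f ≤ 1 := Iff.rfl

theorem X_notMem_infinityPlace_ring : X W ∉ (infinityPlace W).ring := by
  rw [mem_infinityPlace_ring_iff, infinityValuation_X, ← WithZero.exp_zero, WithZero.exp_le_exp]
  omega

/-- At a pole of `X` the cubic side is dominated by `X ^ 3`. This forces `Y` to have a larger pole
than `X`, and then `Y ^ 2` dominates the other side. -/
theorem Place.valuation_Y_sq {P : Place F W.toAffine.FunctionField} (hX : 1 < P.valuation (X W)) :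
    P.valuation (Y W) ^ 2 = P.valuation (X W) ^ 3 := by
  have hc := P.valuation_algebraMap_le_one
  have hY := congrArg P.valuation (equation_X_Y (W := W))
  have hcub : P.valuation (X W ^ 3 + algebraMap F _ W.a₂ * X W ^ 2 + algebraMap F _ W.a₄ * X W +
      algebraMap F W.toAffine.FunctionField W.a₆) = P.valuation (X W) ^ 3 := by
    have h := Polynomial.valuation_aeval_eq_valuation_X_pow_natDegree_of_one_lt_valuation_X
      (v := P.valuation) (A := F) (X W) hX
      (p := Polynomial.C 1 * Polynomial.X ^ 3 + Polynomial.C W.a₂ * Polynomial.X ^ 2 +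
        Polynomial.C W.a₄ * Polynomial.X + Polynomial.C W.a₆)
      (fun h0 => by
        have := Polynomial.natDegree_cubic (b := W.a₂) (c := W.a₄) (d := W.a₆) (one_ne_zero' F)
        rw [h0] at this
        simp at this)
    rw [Polynomial.natDegree_cubic (one_ne_zero' F)] at h
    simpa using h
  rw [hcub] at hY
  set x := P.valuation (X W)
  set y := P.valuation (Y W) with hy
  have hxy : x < y := by
    by_contra! hle
    have h1 : P.valuation (Y W ^ 2 + algebraMap F _ W.a₁ * X W * Y W +
        algebraMap F _ W.a₃ * Y W) ≤ x ^ 2 := by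
      refine P.valuation.map_add_le (P.valuation.map_add_le ?_ ?_) ?_
      · rw [map_pow]
        exact pow_le_pow_left₀ zero_le hle 2
      · rw [map_mul, map_mul, mul_assoc, sq]
        exact (mul_le_of_le_one_left' (hc _)).trans (mul_le_mul_right hle x)
      · rw [map_mul]
        exact (mul_le_of_le_one_left' (hc _)).trans (hle.trans (le_self_pow₀ hX.le two_ne_zero))
    rw [hY] at h1
    exact h1.not_gt (pow_lt_pow_right₀ hX (by norm_num))
  have hy0 : 0 < y := zero_le.trans_lt hxy
  have hy1 : 1 < y := hX.trans hxy
  rw [← hY, add_assoc, Valuation.map_add_eq_of_lt_left, map_pow]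
  rw [map_pow]
  refine P.valuation.map_add_lt ?_ ?_
  · rw [map_mul, map_mul, mul_assoc, sq]
    exact (mul_le_of_le_one_left' (hc _)).trans_lt (mul_lt_mul_of_pos_right hxy hy0)
  · rw [map_mul]
    exact (mul_le_of_le_one_left' (hc _)).trans_lt (lt_self_pow₀ hy1 (by norm_num))

/-- The case `q = 0` is separate because `natDegree 0 = 0` would contribute a spurious 3; for `p =
0` the default is harmless. -/
theorem natDegree_norm_smul_basis (p q : F[X]) :
    (Algebra.norm F[X] (p • (1 : W.toAffine.CoordinateRing) + q • mk W.toAffine Polynomial.X)).natDegree =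
      if q = 0 then 2 * p.natDegree else max (2 * p.natDegree) (2 * q.natDegree + 3) := by
  have h := degree_norm_smul_basis (W' := W.toAffine) p q
  by_cases hp : p = 0 <;> by_cases hq : q = 0
  · simp [hp, hq]
  · rw [hp, Polynomial.degree_eq_natDegree hq] at h
    rw [Polynomial.natDegree_eq_of_degree_eq_some (n := 2 * q.natDegree + 3)]
    · simp [hp, hq]
    · rw [hp, h]
      simp
  · rw [hq, Polynomial.degree_eq_natDegree hp] at h
    rw [Polynomial.natDegree_eq_of_degree_eq_some (n := 2 * p.natDegree)]
    · simp [hq]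
    · rw [hq, h]
      simp
  · rw [Polynomial.degree_eq_natDegree hp, Polynomial.degree_eq_natDegree hq] at h
    rw [if_neg hq]
    refine Polynomial.natDegree_eq_of_degree_eq_some ?_
    rw [h]
    simp only [nsmul_eq_mul, Nat.cast_ofNat]
    rw [(Nat.mono_cast (α := WithBot ℕ)).map_max]
    push_cast
    rfl

/-- At any pole of `X` the valuation of a regular function is governed by the degree of its norm,
exactly as at infinity. Squaring avoids half-integral powers of `v(X)`. -/
theorem Place.valuation_algebraMap_sq {P : Place F W.toAffine.FunctionField}
    (hX : 1 < P.valuation (X W)) {g : W.toAffine.CoordinateRing} (hg : g ≠ 0) :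
    P.valuation (algebraMap _ W.toAffine.FunctionField g) ^ 2 =
      P.valuation (X W) ^ (Algebra.norm F[X] g).natDegree := by
  obtain ⟨p, q, rfl⟩ := exists_smul_basis_eq g
  have hv : ∀ {p : F[X]}, p ≠ 0 →
      P.valuation (Polynomial.aeval (X W) p) = P.valuation (X W) ^ p.natDegree := fun hp =>
    Polynomial.valuation_aeval_eq_valuation_X_pow_natDegree_of_one_lt_valuation_X _ hX hp
  have hvp : ∀ {p : F[X]}, p ≠ 0 →
      P.valuation (Polynomial.aeval (X W) p) ^ 2 = P.valuation (X W) ^ (2 * p.natDegree) :=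
    fun hp => by rw [hv hp, ← pow_mul, mul_comm]
  have hvq : ∀ {q : F[X]}, q ≠ 0 → P.valuation (Polynomial.aeval (X W) q * Y W) ^ 2 =
      P.valuation (X W) ^ (2 * q.natDegree + 3) := fun hq => by
    rw [map_mul, mul_pow, hvp hq, P.valuation_Y_sq hX, ← pow_add]
  have hlt : ∀ {m n : ℕ} {a b : W.toAffine.FunctionField}, m < n →
      P.valuation a ^ 2 = P.valuation (X W) ^ m → P.valuation b ^ 2 = P.valuation (X W) ^ n →
      P.valuation a < P.valuation b := fun hmn ha hb => by
    refine lt_of_pow_lt_pow_left₀ 2 zero_le ?_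
    rw [ha, hb]
    exact pow_lt_pow_right₀ hX hmn
  rw [natDegree_norm_smul_basis, algebraMap_smul_basis]
  by_cases hq : q = 0
  · subst hq
    have hp : p ≠ 0 := by
      rintro rfl
      simp at hg
    simp [hvp hp]
  rw [if_neg hq]
  by_cases hp : p = 0
  · subst hp
    simpa using hvq hq
  rcases lt_or_ge (2 * p.natDegree) (2 * q.natDegree + 3) with h | h
  · rw [Valuation.map_add_eq_of_lt_right _ (hlt h (hvp hp) (hvq hq)), hvq hq, max_eq_right h.le]
  · have h' : 2 * q.natDegree + 3 < 2 * p.natDegree := by omega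
    rw [Valuation.map_add_eq_of_lt_left _ (hlt h' (hvq hq) (hvp hp)), hvp hp, max_eq_left h]

theorem eq_infinityPlace_of_X_notMem {P : Place F W.toAffine.FunctionField} (hX : X W ∉ P.ring) :
    P = infinityPlace W := by
  rw [← P.valuation_le_one_iff, not_le] at hX
  refine (Place.eq_of_ring_le fun f hf => ?_).symm
  rw [mem_infinityPlace_ring_iff] at hf
  rw [← P.valuation_le_one_iff]
  obtain ⟨g, h, hh, rfl⟩ := IsFractionRing.div_surjective (A := W.toAffine.CoordinateRing) f
  have hh0 : h ≠ 0 := nonZeroDivisors.ne_zero hh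
  have hK : algebraMap _ W.toAffine.FunctionField h ≠ 0 := by
    rwa [Ne, FaithfulSMul.algebraMap_eq_zero_iff]
  by_cases hg : g = 0
  · simp [hg]
  rw [map_div₀, div_le_one₀ (zero_lt_iff.2 ((Valuation.ne_zero_iff _).2 hK))] at hf ⊢
  rw [infinityValuation_algebraMap _ _ hg, infinityValuation_algebraMap _ _ hh0,
    WithZero.exp_le_exp] at hf
  refine le_of_pow_le_pow_left₀ two_ne_zero zero_le ?_
  rw [P.valuation_algebraMap_sq hX hg, P.valuation_algebraMap_sq hX hh0]
  exact pow_le_pow_right₀ hX.le (by exact_mod_cast hf)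

theorem X_mem_ring_iff {P : Place F W.toAffine.FunctionField} :
    X W ∈ P.ring ↔ P ≠ infinityPlace W := by
  refine ⟨fun h he => X_notMem_infinityPlace_ring (he ▸ h), fun h => ?_⟩
  by_contra hX
  exact h (eq_infinityPlace_of_X_notMem hX)

theorem affinePlace_ne_infinityPlace {a b : F} (h : W.toAffine.Nonsingular a b) :
    affinePlace h ≠ infinityPlace W := X_mem_ring_iff.1 (X_mem_affinePlace_ring h)

/-- A Dedekind domain is the intersection of its localizations at nonzero primes; each such
localization is a place where `X` is regular, hence not the one at infinity. -/
theorem mem_range_algebraMap_iff [W.IsElliptic] (f : W.toAffine.FunctionField) :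
    f ∈ (algebraMap W.toAffine.CoordinateRing W.toAffine.FunctionField).range ↔
      ∀ P : Place F W.toAffine.FunctionField, P ≠ infinityPlace W → f ∈ P.ring := by
  constructor
  · rintro ⟨g, rfl⟩ P hP
    exact P.algebraMap_mem_ring (X_mem_ring_iff.2 hP) g
  intro h
  refine IsDedekindDomain.HeightOneSpectrum.mem_integers_of_valuation_le_one _ f fun v => ?_
  have hR : ∀ g : W.toAffine.CoordinateRing, algebraMap _ W.toAffine.FunctionField g ∈
      v.valuationSubringAtPrime W.toAffine.FunctionField := fun g =>
    (algebraMap W.toAffine.CoordinateRing (v.valuationSubringAtPrime W.toAffine.FunctionField) g).2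
  have hdvr : IsDiscreteValuationRing (v.valuationSubringAtPrime W.toAffine.FunctionField) :=
    IsLocalization.AtPrime.isDiscreteValuationRing_of_dedekind_domain W.toAffine.CoordinateRing
      v.ne_bot _
  let P : Place F W.toAffine.FunctionField :=
    { ring := v.valuationSubringAtPrime W.toAffine.FunctionField
      algebraMap_mem := fun c => by
        rw [IsScalarTower.algebraMap_apply F W.toAffine.CoordinateRing W.toAffine.FunctionField]
        exact hR _
      isDVR := hdvr }
  exact v.valuationSubringAtPrime_le_valuation (h P (X_mem_ring_iff.1 (hR _)))

end InfinityPlace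

/-! ### The divisor of a vertical line. -/

section VerticalLine

variable {F : Type*} [Field F] {W : WeierstrassCurve F}

theorem XYIdeal_neg_mul_pointIdeal {a b : F} (h : W.toAffine.Nonsingular a b)
    (h' : W.toAffine.Nonsingular a (W.toAffine.negY a b)) :
    pointIdeal h' * pointIdeal h = Ideal.span {XClass W.toAffine a} := XYIdeal_neg_mul h

/-- The ideal `(X - a)` is the product of the ideals of `P` and `-P`. When `P ≠ -P` the second
becomes trivial in the local ring at `P`, so `X - a` is a uniformizer. -/
theorem affinePlace_valuation_X_sub {a b : F} (h : W.toAffine.Nonsingular a b)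
    (hb : b ≠ W.toAffine.negY a b) :
    (affinePlace h).valuation (X W - algebraMap F _ a) = WithZero.exp (-1) := by
  have h' := (WeierstrassCurve.Affine.nonsingular_neg a b).2 h
  have hXcl : algebraMap _ W.toAffine.FunctionField (XClass W.toAffine a) =
      X W - algebraMap F _ a := by
    rw [← algebraMap_mk_C_X_sub, XClass]
    simp only [map_sub]
    rfl
  have hmap : (pointIdeal h).map (algebraMap _ (localRing h)) =
      IsLocalRing.maximalIdeal (localRing h) :=
    IsLocalization.AtPrime.map_eq_maximalIdeal (pointIdeal h) (localRing h)
  have htop : (pointIdeal h').map (algebraMap _ (localRing h)) = ⊤ := by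
    have hY : mk W.toAffine Polynomial.X - algebraMap F _ (W.toAffine.negY a b) ∈ pointIdeal h' := by
      rw [pointIdeal_eq_span]
      exact Ideal.subset_span (Set.mem_insert_of_mem _ rfl)
    have hY' : mk W.toAffine Polynomial.X - algebraMap F _ (W.toAffine.negY a b) ∉ pointIdeal h := by
      rw [← affinePlace_valuation_lt_one_iff, algebraMap_mk_Y_sub]
      intro hlt
      have h2 := (affinePlace h).valuation.map_sub_lt hlt (affinePlace_valuation_Y_sub_lt_one h)
      rw [sub_sub_sub_cancel_left, ← map_sub, Place.valuation_algebraMap_lt_one_iff,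
        sub_eq_zero] at h2
      exact hb h2
    exact Ideal.eq_top_of_isUnit_mem _ (Ideal.mem_map_of_mem _ hY)
      (IsLocalization.map_units (localRing h)
        (⟨_, hY'⟩ : (pointIdeal h).primeCompl))
  have hmax : IsLocalRing.maximalIdeal (localRing h) =
      Ideal.span {algebraMap _ (localRing h) (XClass W.toAffine a)} := by
    have := congrArg (Ideal.map (algebraMap _ (localRing h))) (XYIdeal_neg_mul_pointIdeal h h')
    rwa [Ideal.map_mul, htop, hmap, Ideal.map_span, Set.image_singleton, Ideal.top_mul] at this
  have hne : algebraMap _ (localRing h) (XClass W.toAffine a) ≠ 0 := fun h0 =>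
    XClass_ne_zero (W' := W.toAffine) a
      (IsLocalization.injective _ (Ideal.primeCompl_le_nonZeroDivisors (pointIdeal h))
        (h0.trans (map_zero _).symm))
  rw [← hXcl]
  exact ((IsDiscreteValuationRing.maximalIdeal (localRing h)).valuation_of_algebraMap
    (K := W.toAffine.FunctionField) _).trans
    (IsDedekindDomain.HeightOneSpectrum.intValuation_singleton _ hne hmax)

theorem valuation_X_sub {P : Place F W.toAffine.FunctionField} (hP : P ≠ infinityPlace W)
    {a b : F} (h : W.toAffine.Nonsingular a b)
    (h' : W.toAffine.Nonsingular a (W.toAffine.negY a b)) (hb : b ≠ W.toAffine.negY a b) :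
    P.valuation (X W - algebraMap F _ a) = WithZero.exp
      (-((Finsupp.single (affinePlace h) 1 + Finsupp.single (affinePlace h') 1 :
        Divisor F W.toAffine.FunctionField) P)) := by
  have hne : affinePlace h ≠ affinePlace h' := fun he => by
    have h1 := affinePlace_valuation_Y_sub_lt_one h
    rw [he] at h1
    have h2 := (affinePlace h').valuation.map_sub_lt h1 (affinePlace_valuation_Y_sub_lt_one h')
    rw [sub_sub_sub_cancel_left, ← map_sub, Place.valuation_algebraMap_lt_one_iff,
      sub_eq_zero] at h2
    exact hb h2.symm
  by_cases h1 : P = affinePlace h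
  · subst h1
    rw [affinePlace_valuation_X_sub h hb]
    simp [hne.symm]
  by_cases h2 : P = affinePlace h'
  · subst h2
    rw [affinePlace_valuation_X_sub h' (by rw [WeierstrassCurve.Affine.negY_negY]; exact hb.symm)]
    simp [hne]
  have hX := X_mem_ring_iff.2 hP
  rw [Finsupp.add_apply, Finsupp.single_eq_of_ne h1, Finsupp.single_eq_of_ne h2, add_zero, neg_zero,
    WithZero.exp_zero]
  refine le_antisymm ((P.valuation_le_one_iff _).2 (sub_mem hX (P.algebraMap_mem _)))
    (not_lt.1 fun hlt => ?_)
  have hprime := P.isPrime_center hX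
  have hmem : XClass W.toAffine a ∈ P.center hX := by
    rw [← algebraMap_mk_C_X_sub] at hlt
    rw [XClass, map_sub, map_sub]
    exact hlt
  -- A prime center containing `X - a` contains the ideal of `P` or of `-P`, so the line has no
  -- further affine zeros.
  have hle : pointIdeal h' * pointIdeal h ≤ P.center hX := by
    rw [XYIdeal_neg_mul_pointIdeal h h', Ideal.span_singleton_le_iff_mem]
    exact hmem
  have hmaxl : ∀ {c d : F} (h : W.toAffine.Nonsingular c d), (pointIdeal h).IsMaximal :=
    fun h => inferInstance
  rcases hprime.mul_le.1 hle with hc | hc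
  · exact h2 (eq_affinePlace_of_center hX h' ((hmaxl h').eq_of_le hprime.ne_top hc).symm)
  · exact h1 (eq_affinePlace_of_center hX h ((hmaxl h).eq_of_le hprime.ne_top hc).symm)

end VerticalLine

end QCElliptic

/-- Discrete valuations with the same ring are proportional. As both attain `exp (-1)` the factor is
a unit of `ℤ`, and its sign is fixed by elements of valuation at most 1. -/
theorem Valuation.eq_of_le_one_iff {K : Type*} [Field K] {v w : Valuation K ℤᵐ⁰}
    (h : ∀ f, v f ≤ 1 ↔ w f ≤ 1) {u u' : K} (hu : v u = WithZero.exp (-1))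
    (hu' : w u' = WithZero.exp (-1)) : v = w := by
  have hinv : ∀ (v : Valuation K ℤᵐ⁰) {f : K}, f ≠ 0 → (v f = 1 ↔ v f ≤ 1 ∧ v f⁻¹ ≤ 1) :=
    fun v f hf => by
      rw [map_inv₀, inv_le_one₀ (zero_lt_iff.2 ((Valuation.ne_zero_iff _).2 hf))]
      exact ⟨fun h => ⟨h.le, h.ge⟩, fun h => le_antisymm h.1 h.2⟩
  have heq : ∀ {f : K}, f ≠ 0 → v f = 1 → w f = 1 := fun {f} hf h1 => by
    rw [hinv _ hf] at h1 ⊢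
    rwa [← h, ← h]
  have hexp : ∀ (v : Valuation K ℤᵐ⁰) {f : K}, f ≠ 0 → ∃ n : ℤ, v f = WithZero.exp n :=
    fun v f hf => ⟨_, (WithZero.exp_log ((Valuation.ne_zero_iff _).2 hf)).symm⟩
  have hu0 : u ≠ 0 := by
    rintro rfl
    exact WithZero.exp_ne_zero (hu.symm.trans (map_zero v))
  have hu0' : u' ≠ 0 := by
    rintro rfl
    exact WithZero.exp_ne_zero (hu'.symm.trans (map_zero w))
  obtain ⟨n, hn⟩ := hexp w hu0
  have key : ∀ {f : K} {m : ℤ}, f ≠ 0 → v f = WithZero.exp m → w f = WithZero.exp (-(n * m)) := by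
    intro f m hf hm
    have h1 : v (f * u ^ m) = 1 := by
      rw [map_mul, map_zpow₀, hu, hm, ← WithZero.exp_zsmul, ← WithZero.exp_add]
      simp
    have h2 := heq (mul_ne_zero hf (zpow_ne_zero m hu0)) h1
    rw [map_mul, map_zpow₀, hn, ← WithZero.exp_zsmul] at h2
    rw [eq_inv_of_mul_eq_one_left h2, ← WithZero.exp_neg]
    congr 2
    rw [smul_eq_mul, mul_comm]
  obtain ⟨m, hm⟩ := hexp v hu0'
  have hnm := key hu0' hm
  rw [hu', WithZero.exp_inj] at hnm
  have hn0 : n ≤ 0 := by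
    have := (h u).1 (by rw [hu, ← WithZero.exp_zero, WithZero.exp_le_exp]; omega)
    rwa [hn, ← WithZero.exp_zero, WithZero.exp_le_exp] at this
  have hn1 : n = -1 := by
    have := Int.eq_one_or_neg_one_of_mul_eq_one (show n * m = 1 by omega)
    omega
  ext f
  rcases eq_or_ne f 0 with rfl | hf
  · simp
  obtain ⟨k, hk⟩ := hexp v hf
  rw [hk, key hf hk, hn1]
  congr 1
  ring

namespace QCElliptic

open WeierstrassCurve.Affine WeierstrassCurve.Affine.CoordinateRing

/-! ### Automorphisms fixing infinity, and their fixed points. -/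

section Automorphisms

variable {F : Type*} [Field F] {W : WeierstrassCurve F}
  {σ : W.toAffine.FunctionField ≃ₐ[F] W.toAffine.FunctionField}

/-- `σ` preserves the valuation ring at infinity, and `X / Y` is a uniformizer there, so the two
normalized valuations coincide. -/
theorem infinityValuation_map (hσ : σ • infinityPlace W = infinityPlace W)
    (f : W.toAffine.FunctionField) : infinityValuation W (σ f) = infinityValuation W f := by
  have hu : infinityValuation W (X W / Y W) = WithZero.exp (-1) := by
    rw [map_div₀, infinityValuation_X, infinityValuation_Y, ← WithZero.exp_sub]
    rfl
  have h := Valuation.eq_of_le_one_iff (v := infinityValuation W)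
    (w := (infinityValuation W).comap (σ : W.toAffine.FunctionField →+* W.toAffine.FunctionField))
    (u := X W / Y W) (u' := σ.symm (X W / Y W)) (fun f => ?_) hu ?_
  · exact (congrArg (fun v : Valuation W.toAffine.FunctionField ℤᵐ⁰ => v f) h).symm
  · rw [Valuation.comap_apply, ← mem_infinityPlace_ring_iff, ← mem_infinityPlace_ring_iff]
    nth_rw 2 [← hσ]
    rw [Place.mem_smul_ring_iff]
    simp
  · rw [Valuation.comap_apply]
    simpa using hu

theorem map_mem_range_algebraMap [W.IsElliptic] (hσ : σ • infinityPlace W = infinityPlace W)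
    {f : W.toAffine.FunctionField}
    (hf : f ∈ (algebraMap W.toAffine.CoordinateRing W.toAffine.FunctionField).range) :
    σ f ∈ (algebraMap W.toAffine.CoordinateRing W.toAffine.FunctionField).range := by
  rw [mem_range_algebraMap_iff] at hf ⊢
  intro P hP
  have h := hf (σ⁻¹ • P) fun he => hP (by rw [← hσ, ← he, smul_inv_smul])
  rwa [Place.mem_smul_ring_iff] at h

theorem aeval_X_add_aeval_X_mul_Y_eq_zero {p q : F[X]}
    (h : Polynomial.aeval (X W) p + Polynomial.aeval (X W) q * Y W = 0) : p = 0 ∧ q = 0 := by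
  rw [← algebraMap_smul_basis, FaithfulSMul.algebraMap_eq_zero_iff] at h
  exact smul_basis_eq_zero h

theorem eq_zero_of_linear_combination_eq_zero {c d e : F}
    (h : algebraMap F _ c * Y W + algebraMap F _ d * X W +
      algebraMap F W.toAffine.FunctionField e = 0) : c = 0 ∧ d = 0 ∧ e = 0 := by
  obtain ⟨hp, hq⟩ := aeval_X_add_aeval_X_mul_Y_eq_zero (W := W)
    (p := Polynomial.C d * Polynomial.X + Polynomial.C e) (q := Polynomial.C c) (by
      simp only [map_add, map_mul, Polynomial.aeval_C, Polynomial.aeval_X]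
      linear_combination h)
  have h0 := congrArg (Polynomial.coeff · 0) hp
  have h1 := congrArg (Polynomial.coeff · 1) hp
  simp at h0 h1 hq
  exact ⟨hq, h1, h0⟩

/-- `σ X` is regular on the affine curve with a pole of order 2 at infinity, which rules out a `Y`
term and bounds the degree in `X`. -/
theorem exists_map_X [W.IsElliptic] (hσ : σ • infinityPlace W = infinityPlace W) :
    ∃ a b : F, σ (X W) = algebraMap F _ a * X W + algebraMap F _ b := by
  obtain ⟨g, hg⟩ := map_mem_range_algebraMap hσ (f := X W) ⟨_, rfl⟩
  have hv := infinityValuation_map hσ (X W)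
  have hg0 : g ≠ 0 := by
    rintro rfl
    rw [← hg, map_zero, map_zero, infinityValuation_X] at hv
    exact WithZero.exp_ne_zero hv.symm
  rw [← hg, infinityValuation_algebraMap _ _ hg0, infinityValuation_X, WithZero.exp_inj] at hv
  obtain ⟨p, q, rfl⟩ := exists_smul_basis_eq g
  rw [natDegree_norm_smul_basis] at hv
  have hq : q = 0 := by
    by_contra hq
    rw [if_neg hq] at hv
    omega
  rw [if_pos hq] at hv
  obtain ⟨a, b, hp⟩ := Polynomial.exists_eq_X_add_C_of_natDegree_le_one
    (show p.natDegree ≤ 1 by omega)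
  refine ⟨a, b, ?_⟩
  rw [← hg, algebraMap_smul_basis, hq, hp]
  simp

theorem exists_map_Y [W.IsElliptic] (hσ : σ • infinityPlace W = infinityPlace W) :
    ∃ c d e : F, σ (Y W) =
      algebraMap F _ c * Y W + algebraMap F _ d * X W + algebraMap F _ e := by
  obtain ⟨g, hg⟩ := map_mem_range_algebraMap hσ (f := Y W) ⟨_, rfl⟩
  have hv := infinityValuation_map hσ (Y W)
  have hg0 : g ≠ 0 := by
    rintro rfl
    rw [← hg, map_zero, map_zero, infinityValuation_Y] at hv
    exact WithZero.exp_ne_zero hv.symm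
  rw [← hg, infinityValuation_algebraMap _ _ hg0, infinityValuation_Y, WithZero.exp_inj] at hv
  obtain ⟨p, q, rfl⟩ := exists_smul_basis_eq g
  rw [natDegree_norm_smul_basis] at hv
  have hq : q ≠ 0 := by
    intro hq
    rw [if_pos hq] at hv
    omega
  rw [if_neg hq] at hv
  obtain ⟨d, e, hp⟩ := Polynomial.exists_eq_X_add_C_of_natDegree_le_one
    (show p.natDegree ≤ 1 by omega)
  refine ⟨q.coeff 0, d, e, ?_⟩
  rw [← hg, algebraMap_smul_basis, hp,
    Polynomial.eq_C_of_natDegree_eq_zero (show q.natDegree = 0 by omega)]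
  simp
  ring

/-- Apply `σ` to the Weierstrass equation, subtract `c ^ 2` times the original and compare the
coefficients of `X³`, `XY`, `Y`, `X²` and `X`. -/
theorem coefficient_relations {a b c d e : F}
    (hX : σ (X W) = algebraMap F _ a * X W + algebraMap F _ b)
    (hY : σ (Y W) = algebraMap F _ c * Y W + algebraMap F _ d * X W + algebraMap F _ e) :
    c ^ 2 = a ^ 3 ∧
    -c ^ 2 * W.a₁ + 2 * c * d + W.a₁ * a * c = 0 ∧
    -c ^ 2 * W.a₃ + 2 * c * e + W.a₁ * b * c + W.a₃ * c = 0 ∧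
    c ^ 2 * W.a₂ + d ^ 2 + W.a₁ * a * d = 3 * a ^ 2 * b + W.a₂ * a ^ 2 ∧
    c ^ 2 * W.a₄ + 2 * d * e + W.a₁ * (a * e + b * d) + W.a₃ * d =
      3 * a * b ^ 2 + 2 * W.a₂ * a * b + W.a₄ * a := by
  have h := congrArg σ (equation_X_Y (W := W))
  simp only [map_add, map_mul, map_pow, AlgEquiv.commutes, hX, hY] at h
  obtain ⟨hp, hq⟩ := aeval_X_add_aeval_X_mul_Y_eq_zero (W := W)
    (p := Polynomial.C (c ^ 2 - a ^ 3) * Polynomial.X ^ 3 +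
      Polynomial.C (c ^ 2 * W.a₂ + d ^ 2 + W.a₁ * a * d - (3 * a ^ 2 * b + W.a₂ * a ^ 2)) *
        Polynomial.X ^ 2 +
      Polynomial.C (c ^ 2 * W.a₄ + 2 * d * e + W.a₁ * (a * e + b * d) + W.a₃ * d -
        (3 * a * b ^ 2 + 2 * W.a₂ * a * b + W.a₄ * a)) * Polynomial.X +
      Polynomial.C (c ^ 2 * W.a₆ + e ^ 2 + W.a₁ * b * e + W.a₃ * e -
        (b ^ 3 + W.a₂ * b ^ 2 + W.a₄ * b + W.a₆)))
    (q := Polynomial.C (-c ^ 2 * W.a₁ + 2 * c * d + W.a₁ * a * c) * Polynomial.X +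
      Polynomial.C (-c ^ 2 * W.a₃ + 2 * c * e + W.a₁ * b * c + W.a₃ * c)) (by
    simp only [map_add, map_sub, map_neg, map_mul, map_pow, map_ofNat, Polynomial.aeval_C,
      Polynomial.aeval_X]
    linear_combination h - algebraMap F _ c ^ 2 * equation_X_Y (W := W))
  have h1 := congrArg (Polynomial.coeff · 1) hp
  have h2 := congrArg (Polynomial.coeff · 2) hp
  have h3 := congrArg (Polynomial.coeff · 3) hp
  have k0 := congrArg (Polynomial.coeff · 0) hq
  have k1 := congrArg (Polynomial.coeff · 1) hq
  simp only [Polynomial.coeff_add, Polynomial.coeff_C_mul, Polynomial.coeff_X_pow,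
    Polynomial.coeff_X, Polynomial.coeff_C, Polynomial.coeff_zero] at h1 h2 h3 k0 k1
  norm_num at h1 h2 h3 k0 k1
  exact ⟨sub_eq_zero.1 h3, by linear_combination k1, by linear_combination k0,
    sub_eq_zero.1 h2, sub_eq_zero.1 h1⟩

theorem eq_one_of_map_X_of_map_Y (hX : σ (X W) = X W) (hY : σ (Y W) = Y W) : σ = 1 := by
  have hg : ∀ g : W.toAffine.CoordinateRing, σ (algebraMap _ _ g) = algebraMap _ _ g := by
    intro g
    obtain ⟨p, q, rfl⟩ := exists_smul_basis_eq g
    have hp : ∀ p : F[X], σ (Polynomial.aeval (X W) p) = Polynomial.aeval (X W) p := fun p => by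
      rw [← Polynomial.aeval_algHom_apply, hX]
    rw [algebraMap_smul_basis, map_add, map_mul, hp, hp, hY]
  ext f
  obtain ⟨g, h, -, rfl⟩ := IsFractionRing.div_surjective (A := W.toAffine.CoordinateRing) f
  rw [map_div₀, hg, hg]
  rfl

theorem map_Y_of_map_X (hX : σ (X W) = X W) :
    σ (Y W) = Y W ∨ σ (Y W) = -Y W - algebraMap F _ W.a₁ * X W - algebraMap F _ W.a₃ := by
  have h := congrArg σ (equation_X_Y (W := W))
  simp only [map_add, map_mul, map_pow, AlgEquiv.commutes, hX] at h
  have h2 : (σ (Y W) - Y W) *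
      (σ (Y W) - (-Y W - algebraMap F _ W.a₁ * X W - algebraMap F _ W.a₃)) = 0 := by
    linear_combination h - equation_X_Y (W := W)
  exact (mul_eq_zero.1 h2).imp sub_eq_zero.1 sub_eq_zero.1

/-- Negation is the only involution: once `X` is shown to be fixed, `Y` goes to one of the two roots
of the Weierstrass equation, and fixing it would give the identity. -/
theorem map_X_map_Y_of_orderOf_eq_two [W.IsElliptic]
    (hσ : σ • infinityPlace W = infinityPlace W) (h2 : orderOf σ = 2) :
    σ (X W) = X W ∧ σ (Y W) = -Y W - algebraMap F _ W.a₁ * X W - algebraMap F _ W.a₃ := by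
  have hne : σ ≠ 1 := by
    rintro rfl
    simp at h2
  have hsq : ∀ f, σ (σ f) = f := fun f => by
    have := pow_orderOf_eq_one σ
    rw [h2, sq] at this
    exact congrArg (fun τ : W.toAffine.FunctionField ≃ₐ[F] W.toAffine.FunctionField => τ f) this
  have hX : σ (X W) = X W := by
    obtain ⟨a, b, hX⟩ := exists_map_X hσ
    obtain ⟨c, d, e, hY⟩ := exists_map_Y hσ
    obtain ⟨r1, -, r3, r4, -⟩ := coefficient_relations hX hY
    have hXX := hsq (X W)
    have hYY := hsq (Y W)
    simp only [hX, hY, map_add, map_mul, AlgEquiv.commutes] at hXX hYY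
    obtain ⟨-, s1, s2⟩ := eq_zero_of_linear_combination_eq_zero (W := W)
      (c := 0) (d := a * a - 1) (e := a * b + b) (by
        simp only [map_add, map_sub, map_mul, map_one, map_zero]
        linear_combination hXX)
    obtain ⟨t1, t2, t3⟩ := eq_zero_of_linear_combination_eq_zero (W := W)
      (c := c * c - 1) (d := c * d + d * a) (e := c * e + d * b + e) (by
        simp only [map_add, map_sub, map_mul, map_one]
        linear_combination hYY)
    have ha : a = 1 := by linear_combination (-a) * s1 - r1 + t1
    subst ha
    have hb : b = 0 := by
      -- If `b ≠ 0`, then `2 * b = 0` forces characteristic 2, where `c = 1` and `d = 0`; the `X²`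
      -- relation then reads `3 * b = 0`, which is `b = 0`.
      by_contra hb
      have hb2 : (2 : F) = 0 := by
        refine (mul_eq_zero.1 (?_ : 2 * b = 0)).resolve_right hb
        linear_combination s2
      have hc : c = 1 := by
        have : (c - 1) ^ 2 = 0 := by linear_combination t1 + (1 - c) * hb2
        exact sub_eq_zero.1 (pow_eq_zero_iff two_ne_zero |>.1 this)
      subst hc
      have hd : d = 0 := by
        refine (mul_eq_zero.1 (?_ : d * b = 0)).resolve_right hb
        linear_combination t3 - e * hb2
      subst hd
      have h3 : 3 * b = 0 := by linear_combination -r4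
      exact hb (by linear_combination h3 - b * hb2)
    subst hb
    rw [hX]
    simp
  exact ⟨hX, (map_Y_of_map_X hX).resolve_left fun hY => hne (eq_one_of_map_X_of_map_Y hX hY)⟩

/-- The value of `f` at `σ P` is the value of `σ⁻¹ f` at `P`, so the coordinates of the image point
are read off from `σ.symm`. -/
theorem smul_affinePlace [W.IsElliptic] {x y x' y' : F} (h : W.toAffine.Nonsingular x y)
    (hx : (affinePlace h).valuation (σ.symm (X W) - algebraMap F _ x') < 1)
    (hy : (affinePlace h).valuation (σ.symm (Y W) - algebraMap F _ y') < 1) :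
    ∃ h' : W.toAffine.Nonsingular x' y', σ • affinePlace h = affinePlace h' := by
  have hx' : (σ • affinePlace h).valuation (X W - algebraMap F _ x') < 1 := by
    rw [Place.valuation_smul_lt_one_iff, map_sub, AlgEquiv.commutes]
    exact hx
  have hy' : (σ • affinePlace h).valuation (Y W - algebraMap F _ y') < 1 := by
    rw [Place.valuation_smul_lt_one_iff, map_sub, AlgEquiv.commutes]
    exact hy
  have h' := WeierstrassCurve.Affine.equation_iff_nonsingular.1
    (equation_of_valuation_lt_one hx' hy')
  exact ⟨h', eq_affinePlace_of_valuation_lt_one h' hx' hy'⟩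

theorem affinePlace_valuation_linear_sub_lt_one {x y : F} (h : W.toAffine.Nonsingular x y)
    (c d e : F) :
    (affinePlace h).valuation (algebraMap F _ c * Y W + algebraMap F _ d * X W +
      algebraMap F _ e - algebraMap F _ (c * y + d * x + e)) < 1 := by
  have he : algebraMap F _ c * Y W + algebraMap F _ d * X W +
      algebraMap F _ e - algebraMap F W.toAffine.FunctionField (c * y + d * x + e) =
      algebraMap F _ c * (Y W - algebraMap F _ y) + algebraMap F _ d * (X W - algebraMap F _ x) := by
    simp only [map_add, map_mul]
    ring
  rw [he]
  refine Valuation.map_add_lt _ ?_ ?_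
  · rw [map_mul]
    exact (mul_le_of_le_one_left' (Place.valuation_algebraMap_le_one _ _)).trans_lt
      (affinePlace_valuation_Y_sub_lt_one h)
  · rw [map_mul]
    exact (mul_le_of_le_one_left' (Place.valuation_algebraMap_le_one _ _)).trans_lt
      (affinePlace_valuation_X_sub_lt_one h)

theorem symm_smul_infinityPlace (hσ : σ • infinityPlace W = infinityPlace W) :
    σ⁻¹ • infinityPlace W = infinityPlace W := by
  rw [inv_smul_eq_iff, hσ]

theorem exists_smul_affinePlace_eq [W.IsElliptic] (hσ : σ • infinityPlace W = infinityPlace W)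
    {x y : F} (h : W.toAffine.Nonsingular x y) :
    ∃ (x' y' : F) (h' : W.toAffine.Nonsingular x' y'), σ • affinePlace h = affinePlace h' := by
  obtain ⟨a, b, hX⟩ := exists_map_X (symm_smul_infinityPlace hσ)
  obtain ⟨c, d, e, hY⟩ := exists_map_Y (symm_smul_infinityPlace hσ)
  change σ.symm (X W) = _ at hX
  change σ.symm (Y W) = _ at hY
  refine ⟨_, _, smul_affinePlace (x' := 0 * y + a * x + b) (y' := c * y + d * x + e) h ?_ ?_⟩
  · have := affinePlace_valuation_linear_sub_lt_one h 0 a b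
    rwa [map_zero, zero_mul, zero_add, ← hX] at this
  · rw [hY]
    exact affinePlace_valuation_linear_sub_lt_one h c d e

theorem smul_affinePlace_of_orderOf_eq_two [W.IsElliptic]
    (hσ : σ • infinityPlace W = infinityPlace W) (h2 : orderOf σ = 2) {x y : F}
    (h : W.toAffine.Nonsingular x y) (h' : W.toAffine.Nonsingular x (W.toAffine.negY x y)) :
    σ • affinePlace h = affinePlace h' := by
  obtain ⟨hX, hY⟩ := map_X_map_Y_of_orderOf_eq_two (symm_smul_infinityPlace hσ)
    (by rwa [orderOf_inv])
  change σ.symm (X W) = _ at hX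
  change σ.symm (Y W) = _ at hY
  refine (smul_affinePlace h ?_ ?_).2
  · rw [hX]
    exact affinePlace_valuation_X_sub_lt_one h
  · have := affinePlace_valuation_linear_sub_lt_one h (-1) (-W.a₁) (-W.a₃)
    rw [hY]
    convert this using 2
    simp only [WeierstrassCurve.Affine.negY, map_add, map_sub, map_neg, map_mul, map_one]
    ring

theorem eq_of_affinePlace_eq {x y x' y' : F} {h : W.toAffine.Nonsingular x y}
    {h' : W.toAffine.Nonsingular x' y'} (he : affinePlace h = affinePlace h') :
    x = x' ∧ y = y' := by
  have hx := affinePlace_valuation_X_sub_lt_one h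
  have hy := affinePlace_valuation_Y_sub_lt_one h
  rw [he] at hx hy
  have h1 := (affinePlace h').valuation.map_sub_lt (affinePlace_valuation_X_sub_lt_one h') hx
  have h2 := (affinePlace h').valuation.map_sub_lt (affinePlace_valuation_Y_sub_lt_one h') hy
  rw [sub_sub_sub_cancel_left, ← map_sub, Place.valuation_algebraMap_lt_one_iff, sub_eq_zero]
    at h1 h2
  exact ⟨h1, h2⟩

/-- The hypotheses say that `L` is the tangent slope and that `2Q` has the same `X`-coordinate as
`Q`. So `2Q = ±Q`, and `2Q = Q` would make `Q` zero. -/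
theorem three_smul_eq_zero_of_slope [DecidableEq F] {x y L : F} (h : W.toAffine.Nonsingular x y)
    (hy : y ≠ W.toAffine.negY x y)
    (hL : 3 * x ^ 2 + 2 * W.a₂ * x + W.a₄ - W.a₁ * y = L * (y - W.toAffine.negY x y))
    (hx : L ^ 2 + W.a₁ * L - W.a₂ - x - x = x) :
    3 • (WeierstrassCurve.Affine.Point.some x y h) = 0 := by
  have hs : W.toAffine.slope x x y y = L := by
    rw [WeierstrassCurve.Affine.slope_of_Y_ne rfl hy, hL, mul_div_cancel_right₀ _ (sub_ne_zero.2 hy)]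
  have h2 : 2 • (WeierstrassCurve.Affine.Point.some x y h) =
        WeierstrassCurve.Affine.Point.some x y h ∨
      2 • (WeierstrassCurve.Affine.Point.some x y h) =
        -WeierstrassCurve.Affine.Point.some x y h := by
    rw [two_nsmul, WeierstrassCurve.Affine.Point.add_self_of_Y_ne hy,
      ← WeierstrassCurve.Affine.Point.X_eq_iff, hs]
    exact hx
  rw [show (3 : ℕ) = 2 + 1 from rfl, add_nsmul, one_nsmul]
  rcases h2 with h2 | h2
  · rw [two_nsmul, add_eq_left] at h2
    exact absurd h2 (WeierstrassCurve.Affine.Point.some_ne_zero h)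
  · rw [h2, neg_add_cancel]

theorem three_smul_eq_zero_of_orderOf_eq_three [DecidableEq F] [W.IsElliptic]
    (hσ : σ • infinityPlace W = infinityPlace W) (h3 : orderOf σ = 3) {x y : F}
    (h : W.toAffine.Nonsingular x y) (hy : y ≠ W.toAffine.negY x y)
    (hfix : σ • affinePlace h = affinePlace h) :
    3 • (WeierstrassCurve.Affine.Point.some x y h) = 0 := by
  have hσ' := symm_smul_infinityPlace hσ
  have h3' : orderOf σ⁻¹ = 3 := by rwa [orderOf_inv]
  obtain ⟨a, b, hX⟩ := exists_map_X hσ'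
  obtain ⟨c, d, e, hY⟩ := exists_map_Y hσ'
  obtain ⟨r1, r2, r3, r4, r5⟩ := coefficient_relations hX hY
  have hcube : ∀ f, σ⁻¹ (σ⁻¹ (σ⁻¹ f)) = f := fun f => by
    have := pow_orderOf_eq_one σ⁻¹
    rw [h3', pow_succ, sq] at this
    exact congrArg (fun τ : W.toAffine.FunctionField ≃ₐ[F] W.toAffine.FunctionField => τ f) this
  have hXX := hcube (X W)
  have hYY := hcube (Y W)
  simp only [hX, hY, map_add, map_mul, AlgEquiv.commutes] at hXX hYY
  obtain ⟨-, s1, s2⟩ := eq_zero_of_linear_combination_eq_zero (W := W)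
    (c := 0) (d := a ^ 3 - 1) (e := a ^ 2 * b + a * b + b) (by
      simp only [map_add, map_sub, map_mul, map_one, map_zero, map_pow]
      linear_combination hXX)
  obtain ⟨t1, -, -⟩ := eq_zero_of_linear_combination_eq_zero (W := W)
    (c := c ^ 3 - 1) (d := c ^ 2 * d + c * d * a + d * a ^ 2)
    (e := c ^ 2 * e + c * d * b + c * e + d * a * b + d * b + e) (by
      simp only [map_add, map_sub, map_mul, map_one, map_pow]
      linear_combination hYY)
  -- Both `c ^ 2 = a ^ 3 = 1` and `c ^ 3 = 1`.
  have hc : c = 1 := by linear_combination t1 - c * r1 - c * s1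
  subst hc
  obtain ⟨hx', hy'⟩ : 0 * y + a * x + b = x ∧ 1 * y + d * x + e = y := by
    have hX' : σ.symm (X W) = _ := hX
    have hY' : σ.symm (Y W) = _ := hY
    obtain ⟨h', he⟩ := smul_affinePlace (σ := σ) (x' := 0 * y + a * x + b)
      (y' := 1 * y + d * x + e) h
      (by
        have := affinePlace_valuation_linear_sub_lt_one h 0 a b
        rwa [map_zero, zero_mul, zero_add, ← hX'] at this)
      (by
        rw [hY']
        exact affinePlace_valuation_linear_sub_lt_one h 1 d e)
    exact eq_of_affinePlace_eq (he.symm.trans hfix)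
  by_cases ha : a = 1
  -- With `a = 1` the fixed point forces `b = 0`, so `X` is fixed and the order divides 2.
  · exfalso
    subst ha
    have hb : b = 0 := by linear_combination hx'
    have hX1 : σ⁻¹ (X W) = X W := by rw [hX, hb]; simp
    have hY1 : σ⁻¹ (σ⁻¹ (Y W)) = Y W := by
      rcases map_Y_of_map_X hX1 with hY1 | hY1
      · rw [hY1, hY1]
      · rw [hY1]
        simp only [map_sub, map_neg, map_mul, AlgEquiv.commutes, hX1, hY1]
        ring
    have h1 : σ⁻¹ ^ 2 = 1 := by
      rw [sq]
      refine eq_one_of_map_X_of_map_Y ?_ hY1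
      rw [AlgEquiv.mul_apply, hX1, hX1]
    have := orderOf_dvd_of_pow_eq_one h1
    rw [h3'] at this
    omega
  have ha1 : a - 1 ≠ 0 := sub_ne_zero.2 ha
  have ha2 : a ^ 2 + a + 1 = 0 := by
    refine (mul_eq_zero.1 (?_ : (a ^ 2 + a + 1) * (a - 1) = 0)).resolve_right ha1
    linear_combination s1
  have ha0 : a ≠ 0 := by
    rintro rfl
    simp at ha2
  obtain rfl : b = x - a * x := by linear_combination hx'
  obtain rfl : e = -(d * x) := by linear_combination hy'
  -- Around the fixed point the map is `(u, v) ↦ (a u, v + d u)`, whose only non-vertical eigenline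
  -- has slope `d / (a - 1)`. The tangent there is invariant and not vertical, so this is its slope.
  obtain ⟨L, rfl⟩ : ∃ L, d = L * (a - 1) := ⟨d / (a - 1), (div_mul_cancel₀ _ ha1).symm⟩
  have hL1 : W.a₁ = -2 * L := by
    refine mul_right_cancel₀ ha1 ?_
    linear_combination r2
  have hL2 : L ^ 2 = -(W.a₂ + 3 * x) := by
    refine mul_right_cancel₀ (mul_ne_zero ha1 (pow_ne_zero 2 ha0)) ?_
    rw [hL1] at r4
    linear_combination r4 + (L ^ 2 + W.a₂) * s1
  refine three_smul_eq_zero_of_slope (L := L) h hy ?_ ?_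
  · refine mul_right_cancel₀ ha1 ?_
    rw [WeierstrassCurve.Affine.negY]
    linear_combination -r5 - 2 * x * r4 - y * r2 + 3 * x ^ 2 * s1
  · rw [hL1]
    linear_combination -hL2

end Automorphisms

end QCElliptic

namespace QCElliptic

open WeierstrassCurve.Affine WeierstrassCurve.Affine.CoordinateRing

/-! ### Orbits are free; the degree of the divisor. -/

section Orbits

variable {F : Type*} [Field F] {W : WeierstrassCurve F}
  {σ : W.toAffine.FunctionField ≃ₐ[F] W.toAffine.FunctionField}

theorem pow_smul_infinityPlace (hσ : σ • infinityPlace W = infinityPlace W) (k : ℕ) :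
    σ ^ k • infinityPlace W = infinityPlace W := by
  induction k with
  | zero => rw [pow_zero, one_smul]
  | succ k ih => rw [pow_succ, mul_smul, hσ, ih]

theorem ne_negY_of_two_smul_ne_zero [DecidableEq F] {x y : F} {h : W.toAffine.Nonsingular x y}
    (h2 : 2 • WeierstrassCurve.Affine.Point.some x y h ≠ 0) : y ≠ W.toAffine.negY x y := fun hy =>
  h2 (by rw [two_nsmul, WeierstrassCurve.Affine.Point.add_self_of_Y_eq hy])

theorem ne_zero_of_two_smul_ne_zero [DecidableEq F] {Q : W.toAffine.Point} (h2 : 2 • Q ≠ 0) :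
    Q ≠ 0 := by
  rintro rfl
  exact h2 (smul_zero 2)

theorem orderOf_pow_half (hℓ : orderOf σ = 2 ∨ orderOf σ = 4 ∨ orderOf σ = 6) :
    orderOf (σ ^ (orderOf σ / 2)) = 2 := by
  rw [orderOf_pow_of_dvd (by omega) (Nat.div_dvd_of_dvd (by omega)), Nat.div_div_self] <;> omega

/-- A nontrivial stabilizer in the cyclic group would contain `σ ^ (ℓ / 2)`, of order 2, or, for `ℓ
= 6`, the element `σ ^ 2` of order 3. The first is excluded by `2 • Q ≠ 0`, the second by `3 • Q ≠
0` as well. -/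
theorem pow_smul_placeOf_ne [DecidableEq F] [W.IsElliptic]
    (hσ : σ • infinityPlace W = infinityPlace W)
    (hℓ : orderOf σ = 2 ∨ orderOf σ = 4 ∨ orderOf σ = 6) {Q : W.toAffine.Point}
    (hQ₂ : 2 • Q ≠ 0) (hQ₃ : 3 • Q ≠ 0) {k : ℕ} (hk0 : 0 < k) (hk : k < orderOf σ) :
    σ ^ k • placeOf W Q ≠ placeOf W Q := by
  intro hfix
  obtain _ | ⟨x, y, h⟩ := Q
  · exact hQ₂ (smul_zero 2)
  have hy := ne_negY_of_two_smul_ne_zero hQ₂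
  have hmul : ∀ m : ℕ, σ ^ (k * m) • placeOf W (.some x y h) = placeOf W (.some x y h) := by
    intro m
    induction m with
    | zero => simp
    | succ m ih => rw [mul_add, mul_one, pow_add, mul_smul, hfix, ih]
  have htwo : σ ^ (orderOf σ / 2) • placeOf W (.some x y h) ≠ placeOf W (.some x y h) := fun he => by
    have h' := (WeierstrassCurve.Affine.nonsingular_neg x y).2 h
    have he' := (smul_affinePlace_of_orderOf_eq_two (pow_smul_infinityPlace hσ _)
      (orderOf_pow_half hℓ) h h').symm.trans he
    exact hy (eq_of_affinePlace_eq he').2.symm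
  have hthree : orderOf σ = 6 → σ ^ 2 • placeOf W (.some x y h) ≠ placeOf W (.some x y h) :=
    fun h6 he => hQ₃ (three_smul_eq_zero_of_orderOf_eq_three (pow_smul_infinityPlace hσ 2)
      (by rw [orderOf_pow_of_dvd (by omega) (by omega), h6]) h hy he)
  have hmod : ∀ m n : ℕ, (k * m) % orderOf σ = n →
      σ ^ n • placeOf W (.some x y h) = placeOf W (.some x y h) := fun m n hmn => by
    rw [← hmn, pow_mod_orderOf, hmul]
  rcases hℓ with hl | hl | hl <;> rw [hl] at hk htwo hmod
  · exact htwo (hmod 1 1 (by omega))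
  · obtain rfl | rfl | rfl : k = 1 ∨ k = 2 ∨ k = 3 := by omega
    · exact htwo (hmod 2 2 (by omega))
    · exact htwo (hmod 1 2 (by omega))
    · exact htwo (hmod 2 2 (by omega))
  · obtain rfl | rfl | rfl | rfl | rfl : k = 1 ∨ k = 2 ∨ k = 3 ∨ k = 4 ∨ k = 5 := by omega
    · exact htwo (hmod 3 3 (by omega))
    · exact hthree hl (hmod 1 2 (by omega))
    · exact htwo (hmod 1 3 (by omega))
    · exact hthree hl (hmod 2 2 (by omega))
    · exact htwo (hmod 3 3 (by omega))

theorem exists_pow_smul_placeOf_eq [W.IsElliptic] (hσ : σ • infinityPlace W = infinityPlace W)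
    {Q : W.toAffine.Point} (hQ : Q ≠ 0) (k : ℕ) :
    ∃ (x y : F) (h : W.toAffine.Nonsingular x y), σ ^ k • placeOf W Q = affinePlace h := by
  obtain _ | ⟨x, y, h⟩ := Q
  · exact absurd rfl hQ
  · exact exists_smul_affinePlace_eq (pow_smul_infinityPlace hσ k) h

/-- The orbit is a set, so repeated points would be counted once; freeness shows there are none. -/
theorem sum_orbit_single [DecidableEq F] [W.IsElliptic]
    (hσ : σ • infinityPlace W = infinityPlace W)
    (hℓ : orderOf σ = 2 ∨ orderOf σ = 4 ∨ orderOf σ = 6) {Q : W.toAffine.Point}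
    (hQ₂ : 2 • Q ≠ 0) (hQ₃ : 3 • Q ≠ 0) :
    (∑ P ∈ (placeOf W Q).orbit σ, Finsupp.single P 1 : Divisor F W.toAffine.FunctionField) =
      ∑ i ∈ Finset.range (orderOf σ), Finsupp.single (σ ^ i • placeOf W Q) 1 := by
  have hne : ∀ {i j : ℕ}, i < j → j < orderOf σ →
      σ ^ i • placeOf W Q ≠ σ ^ j • placeOf W Q := fun {i j} hij hj he => by
    refine pow_smul_placeOf_ne hσ hℓ hQ₂ hQ₃ (k := j - i) (by omega) (by omega) ?_
    rw [← Nat.add_sub_of_le hij.le, pow_add, mul_smul, smul_left_cancel_iff] at he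
    exact he.symm
  rw [Place.orbit, Finset.sum_image]
  intro i hi j hj hij
  simp only [Finset.coe_range, Set.mem_Iio] at hi hj
  by_contra hcon
  rcases lt_or_gt_of_ne hcon with hlt | hlt
  · exact hne hlt hj hij
  · exact hne hlt hi hij.symm

theorem Divisor.degree_eq_linearCombination {k K : Type*} [Field k] [Field K] [Algebra k K]
    (G : Divisor k K) :
    G.degree = Finsupp.linearCombination ℤ (fun P : Place k K => (P.degree : ℤ)) G := rfl

theorem degree_orbitDivisor [DecidableEq F] [W.IsElliptic]
    (hσ : σ • infinityPlace W = infinityPlace W)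
    (hℓ : orderOf σ = 2 ∨ orderOf σ = 4 ∨ orderOf σ = 6) {s : ℕ} (t : Fin s → ℤ)
    (Q : Fin s → W.toAffine.Point) (hQ₂ : ∀ z, 2 • Q z ≠ 0) (hQ₃ : ∀ z, 3 • Q z ≠ 0) :
    (orbitDivisor σ t Q).degree = orderOf σ * ∑ z, t z := by
  rw [Divisor.degree_eq_linearCombination, orbitDivisor, map_sum, Finset.mul_sum]
  refine Finset.sum_congr rfl fun z _ => ?_
  rw [sum_orbit_single hσ hℓ (hQ₂ z) (hQ₃ z), map_smul, map_sum, smul_eq_mul, mul_comm]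
  congr 1
  rw [Finset.sum_eq_card_nsmul (b := 1), Finset.card_range, nsmul_one]
  intro i _
  obtain ⟨x, y, h, he⟩ := exists_pow_smul_placeOf_eq hσ
    (ne_zero_of_two_smul_ne_zero (hQ₂ z)) i
  rw [Finsupp.linearCombination_single, he, degree_affinePlace]
  simp

theorem orbitDivisor_infinityPlace (hσ : σ • infinityPlace W = infinityPlace W) {s : ℕ}
    (t : Fin s → ℤ) (Q : Fin s → W.toAffine.Point) (hQ : ∀ z, Q z ≠ 0) :
    orbitDivisor σ t Q (infinityPlace W) = 0 := by
  rw [orbitDivisor, Finsupp.finsetSum_apply]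
  refine Finset.sum_eq_zero fun z _ => ?_
  rw [Finsupp.smul_apply, Finsupp.finsetSum_apply, Finset.sum_eq_zero, smul_zero]
  intro P hP
  refine Finsupp.single_eq_of_ne fun he => ?_
  obtain ⟨i, -, rfl⟩ := Finset.mem_image.1 hP
  rw [← pow_smul_infinityPlace hσ i, smul_left_cancel_iff] at he
  have hz := hQ z
  revert he hz
  rcases Q z with _ | ⟨x, y, h⟩
  · exact fun _ hz => hz rfl
  · exact fun he _ => affinePlace_ne_infinityPlace h he.symm

end Orbits

/-! ### The divisor of the denominator. -/

section Denominator

variable {F : Type*} [Field F] {W : WeierstrassCurve F}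
  (σ : W.toAffine.FunctionField ≃ₐ[F] W.toAffine.FunctionField)

/-- The function `∏_z [∏_ρ (X - x(Q_{z,ρ}))]^{t_z}`. -/
def orbitDenominator {s : ℕ} (t : Fin s → ℤ) (Q : Fin s → W.toAffine.Point) :
    W.toAffine.FunctionField :=
  ∏ z, (∏ ρ ∈ Finset.range (orderOf σ / 2),
      (X W - algebraMap F _ ((σ ^ ρ • placeOf W (Q z)).value (X W)))) ^ t z

theorem basisFunction_eq {s : ℕ} (t : Fin s → ℤ) (Q : Fin s → W.toAffine.Point) (i j : ℕ) :
    basisFunction σ t Q i j = X W ^ i * Y W ^ j / orbitDenominator σ t Q := rfl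

theorem exp_sum {ι : Type*} (S : Finset ι) (f : ι → ℤ) :
    WithZero.exp (∑ i ∈ S, f i) = ∏ i ∈ S, WithZero.exp (f i) := by
  induction S using Finset.induction_on with
  | empty => simp
  | insert a S ha ih => rw [Finset.sum_insert ha, Finset.prod_insert ha, WithZero.exp_add, ih]

variable {σ}

/-- The negative of `σ ^ ρ Q` is `σ ^ (ℓ / 2 + ρ) Q`, and freeness of the orbit makes these two
zeros of the vertical line distinct. -/
theorem valuation_X_sub_value [DecidableEq F] [W.IsElliptic]
    (hσ : σ • infinityPlace W = infinityPlace W)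
    (hℓ : orderOf σ = 2 ∨ orderOf σ = 4 ∨ orderOf σ = 6) {Q : W.toAffine.Point}
    (hQ₂ : 2 • Q ≠ 0) (hQ₃ : 3 • Q ≠ 0) {P : Place F W.toAffine.FunctionField}
    (hP : P ≠ infinityPlace W) (ρ : ℕ) :
    P.valuation (X W - algebraMap F _ ((σ ^ ρ • placeOf W Q).value (X W))) = WithZero.exp
      (-((Finsupp.single (σ ^ ρ • placeOf W Q) 1 +
        Finsupp.single (σ ^ (orderOf σ / 2 + ρ) • placeOf W Q) 1 :
          Divisor F W.toAffine.FunctionField) P)) := by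
  obtain ⟨x, y, h, he⟩ := exists_pow_smul_placeOf_eq hσ
    (ne_zero_of_two_smul_ne_zero hQ₂) ρ
  have h' := (WeierstrassCurve.Affine.nonsingular_neg x y).2 h
  have hτ := smul_affinePlace_of_orderOf_eq_two (pow_smul_infinityPlace hσ _)
    (orderOf_pow_half hℓ) h h'
  have hne : y ≠ W.toAffine.negY x y := by
    intro hy
    have hfix : σ ^ (orderOf σ / 2) • affinePlace h = affinePlace h := by
      rw [hτ]
      congr 1
      exact hy.symm
    rw [← he, ← mul_smul, ← pow_add, add_comm, pow_add, mul_smul, smul_left_cancel_iff] at hfix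
    exact pow_smul_placeOf_ne hσ hℓ hQ₂ hQ₃ (by omega) (by omega) hfix
  rw [pow_add, mul_smul, he, hτ, Place.value_eq _ (affinePlace_valuation_X_sub_lt_one h)]
  exact valuation_X_sub hP h h' hne

theorem valuation_orbitDenominator [DecidableEq F] [W.IsElliptic]
    (hσ : σ • infinityPlace W = infinityPlace W)
    (hℓ : orderOf σ = 2 ∨ orderOf σ = 4 ∨ orderOf σ = 6) {s : ℕ} (t : Fin s → ℤ)
    (Q : Fin s → W.toAffine.Point) (hQ₂ : ∀ z, 2 • Q z ≠ 0) (hQ₃ : ∀ z, 3 • Q z ≠ 0)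
    {P : Place F W.toAffine.FunctionField} (hP : P ≠ infinityPlace W) :
    P.valuation (orbitDenominator σ t Q) = WithZero.exp (-(orbitDivisor σ t Q P)) := by
  rw [orbitDenominator, orbitDivisor, map_prod, Finsupp.finsetSum_apply, ← Finset.sum_neg_distrib,
    exp_sum]
  refine Finset.prod_congr rfl fun z _ => ?_
  rw [map_zpow₀, map_prod, sum_orbit_single hσ hℓ (hQ₂ z) (hQ₃ z), Finsupp.smul_apply, ← smul_neg,
    WithZero.exp_zsmul]
  congr 1
  rw [Finset.prod_congr rfl fun ρ _ => valuation_X_sub_value hσ hℓ (hQ₂ z) (hQ₃ z) hP ρ, ← exp_sum,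
    Finset.sum_neg_distrib]
  -- The exponents `ρ` and `ℓ / 2 + ρ` for `ρ < ℓ / 2` run through the whole orbit once.
  have hhalf : orderOf σ = orderOf σ / 2 + orderOf σ / 2 := by omega
  congr 2
  conv_rhs => rw [hhalf]
  rw [Finset.sum_range_add, Finsupp.add_apply, Finsupp.finsetSum_apply, Finsupp.finsetSum_apply,
    ← Finset.sum_add_distrib]
  rfl

theorem infinityValuation_X_sub (c : F) :
    infinityValuation W (X W - algebraMap F _ c) = WithZero.exp 2 := by
  rw [← infinityValuation_X (W := W)]
  refine Valuation.map_sub_eq_of_lt_left _ ?_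
  have h1 := (mem_infinityPlace_ring_iff _).1 ((infinityPlace W).algebraMap_mem c)
  refine h1.trans_lt ?_
  rw [infinityValuation_X, ← WithZero.exp_zero, WithZero.exp_lt_exp]
  norm_num

theorem infinityValuation_orbitDenominator (hℓ : Even (orderOf σ)) {s : ℕ} (t : Fin s → ℤ)
    (Q : Fin s → W.toAffine.Point) :
    infinityValuation W (orbitDenominator σ t Q) = WithZero.exp (orderOf σ * ∑ z, t z) := by
  rw [orbitDenominator, map_prod, Finset.mul_sum, exp_sum]
  refine Finset.prod_congr rfl fun z _ => ?_
  rw [map_zpow₀, map_prod, Finset.prod_congr rfl fun ρ _ => infinityValuation_X_sub _,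
    Finset.prod_const, Finset.card_range, ← WithZero.exp_nsmul, ← WithZero.exp_zsmul]
  congr 1
  have h2 : ((orderOf σ / 2 : ℕ) : ℤ) * 2 = orderOf σ := by
    exact_mod_cast Nat.div_mul_cancel hℓ.two_dvd
  rw [nsmul_eq_mul, h2, smul_eq_mul, mul_comm]

theorem orbitDenominator_ne_zero (hℓ : Even (orderOf σ)) {s : ℕ} (t : Fin s → ℤ)
    (Q : Fin s → W.toAffine.Point) : orbitDenominator σ t Q ≠ 0 := by
  rw [← Valuation.ne_zero_iff (infinityValuation W), infinityValuation_orbitDenominator hℓ]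
  exact WithZero.exp_ne_zero

end Denominator

/-! ### The Riemann–Roch space as a translate of a space of polynomials. -/

section RiemannRoch

variable {F : Type*} [Field F] {W : WeierstrassCurve F}

theorem linearIndependent_X_pow_mul_Y_pow :
    LinearIndependent F (fun ij : ℕ × Fin 2 => X W ^ ij.1 * Y W ^ (ij.2 : ℕ)) := by
  have hcoe : (fun ij : ℕ × Fin 2 => X W ^ ij.1 * Y W ^ (ij.2 : ℕ)) =
      (IsScalarTower.toAlgHom F W.toAffine.CoordinateRing W.toAffine.FunctionField).toLinearMap ∘
        ((Polynomial.basisMonomials F).smulTower (CoordinateRing.basis W.toAffine)) := by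
    funext ⟨i, j⟩
    have hi : algebraMap W.toAffine.CoordinateRing W.toAffine.FunctionField
        (mk W.toAffine (Polynomial.C (Polynomial.monomial i 1))) = X W ^ i := by
      rw [algebraMap_mk_C, Polynomial.aeval_monomial, map_one, one_mul]
    simp only [Function.comp_apply, Module.Basis.smulTower_apply, Polynomial.coe_basisMonomials,
      AlgHom.toLinearMap_apply, IsScalarTower.toAlgHom_apply, smul, map_mul, hi]
    fin_cases j
    · simp
    · simp [Y]
  rw [hcoe]
  exact ((Polynomial.basisMonomials F).smulTower
    (CoordinateRing.basis W.toAffine)).linearIndependent.map' _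
    (LinearMap.ker_eq_bot.2 (IsFractionRing.injective _ _))

theorem mem_riemannRochSpace_orbitDivisor_iff [DecidableEq F] [W.IsElliptic]
    {σ : W.toAffine.FunctionField ≃ₐ[F] W.toAffine.FunctionField}
    (hσ : σ • infinityPlace W = infinityPlace W)
    (hℓ : orderOf σ = 2 ∨ orderOf σ = 4 ∨ orderOf σ = 6) {s : ℕ} (t : Fin s → ℤ)
    (Q : Fin s → W.toAffine.Point) (hQ₂ : ∀ z, 2 • Q z ≠ 0) (hQ₃ : ∀ z, 3 • Q z ≠ 0)
    (f : W.toAffine.FunctionField) :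
    f ∈ riemannRochSpace (orbitDivisor σ t Q) ↔
      f * orbitDenominator σ t Q ∈
        (algebraMap W.toAffine.CoordinateRing W.toAffine.FunctionField).range ∧
      infinityValuation W (f * orbitDenominator σ t Q) ≤
        WithZero.exp (orderOf σ * ∑ z, t z) := by
  have hQ : ∀ z, Q z ≠ 0 := fun z => ne_zero_of_two_smul_ne_zero (hQ₂ z)
  have hinf : infinityValuation W (f * orbitDenominator σ t Q) ≤
      WithZero.exp (orderOf σ * ∑ z, t z) ↔
      (infinityPlace W).valuation f ≤ WithZero.exp (orbitDivisor σ t Q (infinityPlace W)) := by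
    rw [orbitDivisor_infinityPlace hσ t Q hQ, WithZero.exp_zero, Place.valuation_le_one_iff,
      mem_infinityPlace_ring_iff, map_mul, infinityValuation_orbitDenominator (by
        rcases hℓ with h | h | h <;> rw [h] <;> decide)]
    exact mul_le_iff_le_one_left (WithZero.exp_pos)
  have hfin : ∀ P, P ≠ infinityPlace W → (f * orbitDenominator σ t Q ∈ P.ring ↔
      P.valuation f ≤ WithZero.exp (orbitDivisor σ t Q P)) := fun P hP => by
    rw [← P.valuation_le_one_iff, map_mul, valuation_orbitDenominator hσ hℓ t Q hQ₂ hQ₃ hP,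
      WithZero.exp_neg, ← div_eq_mul_inv, div_le_one₀ WithZero.exp_pos]
  rw [mem_range_algebraMap_iff, hinf]
  refine (mem_riemannRoch_iff _ f).trans ⟨fun h => ⟨fun P hP => (hfin P hP).2 (h P), h _⟩,
    fun h P => ?_⟩
  by_cases hP : P = infinityPlace W
  · rw [hP]
    exact h.2
  · exact (hfin P hP).1 (h.1 P hP)

theorem mem_span_X_pow_mul_Y_pow {N : ℤ} {g : W.toAffine.CoordinateRing}
    (hg : infinityValuation W (algebraMap _ _ g) ≤ WithZero.exp N) :
    algebraMap _ W.toAffine.FunctionField g ∈ Submodule.span F (Set.range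
      (fun ij : {ij : ℕ × Fin 2 // 2 * (ij.1 : ℤ) + 3 * (ij.2 : ℤ) ≤ N} =>
        X W ^ ij.1.1 * Y W ^ (ij.1.2 : ℕ))) := by
  rcases eq_or_ne g 0 with rfl | hg0
  · rw [map_zero]
    exact zero_mem _
  rw [infinityValuation_algebraMap _ _ hg0, WithZero.exp_le_exp] at hg
  obtain ⟨p, q, rfl⟩ := exists_smul_basis_eq g
  rw [natDegree_norm_smul_basis] at hg
  -- The guard `p ≠ 0` matters for `j = 1`: a vanishing `Y`-part says nothing about whether `3 ≤ N`.
  have hmem : ∀ (p : F[X]) (j : Fin 2), (p ≠ 0 → 2 * (p.natDegree : ℤ) + 3 * (j : ℤ) ≤ N) →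
      Polynomial.aeval (X W) p * Y W ^ (j : ℕ) ∈ Submodule.span F (Set.range
      (fun ij : {ij : ℕ × Fin 2 // 2 * (ij.1 : ℤ) + 3 * (ij.2 : ℤ) ≤ N} =>
        X W ^ ij.1.1 * Y W ^ (ij.1.2 : ℕ))) := by
    intro p j hp
    rw [Polynomial.aeval_eq_sum_range, Finset.sum_mul]
    refine sum_mem fun i hi => ?_
    rw [smul_mul_assoc]
    rcases eq_or_ne p 0 with rfl | hp0
    · simp
    refine Submodule.smul_mem _ _ (Submodule.subset_span ⟨⟨(i, j), ?_⟩, rfl⟩)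
    have h1 := hp hp0
    have h2 := Finset.mem_range.1 hi
    dsimp only
    omega
  rw [algebraMap_smul_basis]
  refine add_mem ?_ ?_
  · have := hmem p 0 (fun _ => by
      simp only [Fin.val_zero, Nat.cast_zero]
      split_ifs at hg <;> omega)
    simpa using this
  · have := hmem q 1 (fun hq => by
      rw [if_neg hq] at hg
      simp only [Fin.val_one, Nat.cast_one]
      omega)
    simpa using this

end RiemannRoch

end QCElliptic

end

theorem mainTheorem3 {F : Type*} [Field F] [Finite F] [DecidableEq F]
    (W : WeierstrassCurve F) [W.IsElliptic]
    (σ : W.toAffine.FunctionField ≃ₐ[F] W.toAffine.FunctionField)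
    (hσ : σ • QCElliptic.infinityPlace W = QCElliptic.infinityPlace W)
    (hℓ : orderOf σ = 2 ∨ orderOf σ = 4 ∨ orderOf σ = 6)
    (s : ℕ) (t : Fin s → ℤ) (Q : Fin s → W.toAffine.Point)
    (hQ₂ : ∀ z, 2 • Q z ≠ 0) (hQ₃ : ∀ z, 3 • Q z ≠ 0) :
    (QCElliptic.orbitDivisor σ t Q).degree = orderOf σ * ∑ z, t z ∧
    LinearIndependent F
      (fun ij : {ij : ℕ × Fin 2 // 2 * (ij.1 : ℤ) + 3 * (ij.2 : ℤ) ≤ orderOf σ * ∑ z, t z} =>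
        QCElliptic.basisFunction σ t Q ij.1.1 ij.1.2) ∧
    Submodule.span F (Set.range
      (fun ij : {ij : ℕ × Fin 2 // 2 * (ij.1 : ℤ) + 3 * (ij.2 : ℤ) ≤ orderOf σ * ∑ z, t z} =>
        QCElliptic.basisFunction σ t Q ij.1.1 ij.1.2)) =
      QCElliptic.riemannRochSpace (QCElliptic.orbitDivisor σ t Q) := by
  have hD := QCElliptic.orbitDenominator_ne_zero (σ := σ)
    (by rcases hℓ with h | h | h <;> rw [h] <;> decide) t Q
  set D := QCElliptic.orbitDenominator σ t Q
  -- Multiplication by `D⁻¹` is linear and injective, so it carries both independence and spanning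
  -- over from the monomials.
  have hmul : ∀ i j : ℕ, LinearMap.mulRight F D⁻¹ (QCElliptic.X W ^ i * QCElliptic.Y W ^ j) =
      QCElliptic.basisFunction σ t Q i j := fun i j => by
    rw [QCElliptic.basisFunction_eq, LinearMap.mulRight_apply, div_eq_mul_inv]
  refine ⟨QCElliptic.degree_orbitDivisor hσ hℓ t Q hQ₂ hQ₃, ?_, le_antisymm ?_ fun f hf => ?_⟩
  · have h := (QCElliptic.linearIndependent_X_pow_mul_Y_pow (W := W)).map'
      (LinearMap.mulRight F D⁻¹)
      (LinearMap.ker_eq_bot.2 (mul_left_injective₀ (inv_ne_zero hD)))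
    have h' := h.comp (fun ij : {ij : ℕ × Fin 2 // 2 * (ij.1 : ℤ) + 3 * (ij.2 : ℤ) ≤
      orderOf σ * ∑ z, t z} => ij.1) Subtype.val_injective
    simpa only [Function.comp_def, hmul] using h'
  · rw [Submodule.span_le]
    rintro _ ⟨⟨⟨i, j⟩, hij⟩, rfl⟩
    dsimp only at hij ⊢
    rw [SetLike.mem_coe, QCElliptic.mem_riemannRochSpace_orbitDivisor_iff hσ hℓ t Q hQ₂ hQ₃,
      QCElliptic.basisFunction_eq, div_mul_cancel₀ _ hD, map_mul, map_pow, map_pow,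
      QCElliptic.infinityValuation_X, QCElliptic.infinityValuation_Y, ← WithZero.exp_nsmul,
      ← WithZero.exp_nsmul, ← WithZero.exp_add, WithZero.exp_le_exp]
    refine ⟨mul_mem (pow_mem (RingHom.mem_range_self _ _) _)
      (pow_mem (RingHom.mem_range_self _ _) _), ?_⟩
    simp only [nsmul_eq_mul]
    linarith
  · obtain ⟨⟨g, hg⟩, hv⟩ :=
      (QCElliptic.mem_riemannRochSpace_orbitDivisor_iff hσ hℓ t Q hQ₂ hQ₃ f).1 hf
    rw [← hg] at hv
    have h := Submodule.mem_map_of_mem (f := LinearMap.mulRight F D⁻¹)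
      (QCElliptic.mem_span_X_pow_mul_Y_pow hv)
    rw [hg, LinearMap.mulRight_apply, mul_inv_cancel_right₀ hD, Submodule.map_span,
      ← Set.range_comp] at h
    simpa only [Function.comp_def, hmul] using h
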